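/- **Setting.** Let $X$ be a second-countable locally compact Hausdorff space with its Borel $\sigma$-algebra and $Y$ a real separable Hilbert space. Let $\mathcal H$ be a real reproducing kernel Hilbert space of scalar functions on $X$ with kernel $k$ and feature map $\phi(x)=k(x,\cdot)\in\mathcal H$, where $\phi$ is strongly measurable and $k(x,x)\le\kappa^2$ for all $x\in X$, $\kappa\ge 0$. Let $\mathcal G$ be the $Y$-valued RKHS on $X$ with kernel $K(x,t)=k(x,t)\,\mathrm{Id}_Y$, and write $K_x:Y\to\mathcal G$ for $K_xy=K(\cdot,x)y$. $\mathcal S_2(\mathcal H,Y)$ denotes the Hilbert–Schmidt operators with norm $\|\cdot\|_{\mathcal S_2}$. Let $p_X,q_X$ be probability measures on $X$ and $p(dy\mid x)$ a Markov kernel from $X$ to $Y$; put $p(dx,dy)=p_X(dx)\,p(dy\mid x)$. Assume $dq_X=\beta\,dp_X$ with $\beta:X\to[0,\infty)$ measurable and $\beta\le b$ everywhere, $b>0$, and $\|y\|_Y\le M'$ for $p$-almost every $(x,y)$, $M'>0$. Put $$C_X=\int_X\phi(x)\otimes\phi(x)\,dq_X(x),\qquad \mathcal N(\lambda)=\mathrm{Tr}\big(C_X(C_X+\lambda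 I)^{-1}\big).$$ *Regularization.* Let $s\ge b\kappa^2$ and let $g_\lambda:[0,s]\to\mathbb R$, $0<\lambda\le s$, be functions with constants $D,B,\gamma>0$ such that, for all $0<\lambda\le s$ and $0<\sigma\le s$, $|\sigma g_\lambda(\sigma)|\le D$, $|g_\lambda(\sigma)|\le B/\lambda$ and $|1-\sigma g_\lambda(\sigma)|\le\gamma$. Let $\nu>0$ and $\gamma_\nu$ satisfy $|1-\sigma g_\lambda(\sigma)|\,\sigma^\nu\le\gamma_\nu\lambda^\nu$ for all such $\lambda,\sigma$ (for instance, $\nu$ is the qualification of the family, i.e. the largest such exponent). Let $\varphi:[0,\infty)\to[0,\infty)$ be an index function (continuous, strictly increasing, $\varphi(0)=0$) that is covered by $\nu$: for some $c>0$, $c\,t^\nu/\varphi(t)\le\inf_{t\le\sigma\le s}\sigma^\nu/\varphi(\sigma)$ for all $0<t\le s$. *Source condition.* Let $f^*\in\mathcal G$ be the regression function, $f^*(x)=\int_Y y\,p(dy\mid x)$ for $q_X$-almost every $x$. Write $f^*(x)=C_*\phi(x)$ for all $x\in X$, with $C_*:\mathcal H\to Y$ bounded linear, and assume $C_*=C_o\,\varphi(C_X)$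 for some $C_o\in\mathcal S_2(\mathcal H,Y)$. *Estimator.* Given a sample $\mathbf z=((x_i,y_i))_{i=1}^n$, $n\ge1$, let $S:\mathcal G\to Y^n$, $Sf=(f(x_i))_i$, $S^*\mathbf y=\frac1n\sum_iK_{x_i}y_i$, $\mathcal B=\mathrm{diag}(\beta(x_1),\dots,\beta(x_n))$ and $$\widehat f_{\mathbf z,\lambda}=g_\lambda(S^*\mathcal BS)\,S^*\mathcal B\mathbf y .$$ **Theorem.** Let $0<\delta<1$ and let $0<\lambda\le s$ satisfy $$2\left(\frac{2b\kappa^2}{\sqrt\lambda\,n}+\sqrt{\frac{b\kappa^2\mathcal N(\lambda)}{n}}\right)\log\frac2\delta\le\frac{\sqrt\lambda}{2}.$$ If $\mathbf z$ consists of $n$ independent samples from $p$, then with probability at least $1-\delta$ $$\big\|f^*-\widehat f_{\mathbf z,\lambda}\big\|_{\mathcal G}\le\left(\frac{A_1}{n\lambda}+A_2\sqrt{\frac{\mathcal N(\lambda)}{n\lambda}}\right)\log\frac2\delta+A_3\,\varphi(\lambda),$$ where, with $\bar\nu=\lfloor\nu\rfloor$ and $M=M'+\kappa\|C_*\|_{\mathcal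 S_2}$, $$A_1=2^{2\nu-\bar\nu+2}(\gamma_\nu+\gamma)\max\!\big(1,\tfrac1c\big)\,\bar\nu\,b\,\kappa^2\|C_*\|_{\mathcal S_2}+2\sqrt{10}\,b\,M\,\kappa\,(B+D),$$ $$A_2=2^{2\nu-\bar\nu+1}(\gamma_\nu+\gamma)\max\!\big(1,\tfrac1c\big)\,\bar\nu\,\sqrt b\,\kappa\,\|C_*\|_{\mathcal S_2}+\sqrt{10}\,\sqrt b\,M\,(B+D),$$ $$A_3=2^{2\nu-\bar\nu}(\gamma_\nu+\gamma)\max\!\big(1,\tfrac1c\big)\,\|C_o\|_{\mathcal S_2}.$$ (Precisely: the set of samples for which the bound fails has outer measure at most $\delta$ under the $n$-fold product of $p$.) -/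

import Mathlib

open MeasureTheory ProbabilityTheory
open scoped RealInnerProductSpace

noncomputable section

namespace CovShift

section Operators

variable {E F : Type*} [NormedAddCommGroup E] [InnerProductSpace ℝ E] [CompleteSpace E]
  [NormedAddCommGroup F] [InnerProductSpace ℝ F]

/-- Functional calculus `f(A) v = ∑_μ f(μ) P_μ v` of an operator `A` whose eigenspaces span a dense
subspace (compact self-adjoint operators, self-adjoint operators with finite spectrum); `P_μ` is the
orthogonal projection onto `ker (A - μ)`, which is zero unless `μ` is an eigenvalue. -/
def funcCalc (A : E →L[ℝ] E) (f : ℝ → ℝ) (v : E) : E :=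
  ∑' μ : ℝ, f μ • (A - μ • ContinuousLinearMap.id ℝ E).ker.starProjection v

variable (E) in
/-- Index set of a fixed orthonormal (Hilbert) basis of `E`. -/
def basisIndex : Set E := (exists_hilbertBasis ℝ E).choose

variable (E) in
/-- A fixed orthonormal (Hilbert) basis of `E`. -/
def onb : HilbertBasis (basisIndex E) ℝ E := (exists_hilbertBasis ℝ E).choose_spec.choose

/-- `T ∈ 𝒮₂(E, F)`; this does not depend on the orthonormal basis. -/
def IsHilbertSchmidt (T : E →L[ℝ] F) : Prop :=
  Summable fun i => ‖T (onb E i)‖ ^ 2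

/-- The Hilbert–Schmidt norm `‖T‖_{𝒮₂(E, F)}`; it does not depend on the orthonormal basis. -/
def hsNorm (T : E →L[ℝ] F) : ℝ :=
  Real.sqrt (∑' i, ‖T (onb E i)‖ ^ 2)

/-- The trace `∑ ⟪eᵢ, T eᵢ⟫` (used for positive trace class operators, where it does not depend on
the orthonormal basis). -/
def trace (T : E →L[ℝ] E) : ℝ :=
  ∑' i, ⟪onb E i, T (onb E i)⟫

/-- `𝒩(lam) = Tr (C (C + lam I)⁻¹)`. -/
def effDim (C : E →L[ℝ] E) (lam : ℝ) : ℝ :=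
  trace (C * Ring.inverse (C + lam • (1 : E →L[ℝ] E)))

end Operators

section Regularization

/-- The family `g lam : [0, s] → ℝ`, `0 < lam ≤ s`, is a regularization family with constants
`D`, `B`, `γ`. -/
structure IsRegularizationFamily (s : ℝ) (g : ℝ → ℝ → ℝ) (D B γ : ℝ) : Prop where
  D_pos : 0 < D
  B_pos : 0 < B
  γ_pos : 0 < γ
  bound_mul : ∀ lam ∈ Set.Ioc 0 s, ∀ σ ∈ Set.Ioc 0 s, |σ * g lam σ| ≤ D
  bound : ∀ lam ∈ Set.Ioc 0 s, ∀ σ ∈ Set.Ioc 0 s, |g lam σ| ≤ B / lam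
  bound_residual : ∀ lam ∈ Set.Ioc 0 s, ∀ σ ∈ Set.Ioc 0 s, |1 - σ * g lam σ| ≤ γ

/-- The inequality that defines the qualification, for the exponent `ν`, with constant `γν`. The
qualification is the largest such exponent; maximality is not required here, so that families with
infinite qualification are included. -/
def HasQualification (s : ℝ) (g : ℝ → ℝ → ℝ) (ν γν : ℝ) : Prop :=
  0 < ν ∧ ∀ lam ∈ Set.Ioc 0 s, ∀ σ ∈ Set.Ioc 0 s,
    |1 - σ * g lam σ| * σ ^ ν ≤ γν * lam ^ ν

/-- Index functions on `[0, ∞)`. -/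
structure IsIndexFunction (φ : ℝ → ℝ) : Prop where
  continuousOn : ContinuousOn φ (Set.Ici 0)
  strictMonoOn : StrictMonoOn φ (Set.Ici 0)
  map_zero : φ 0 = 0

/-- The exponent `ν` covers the index function `φ` on `(0, s]` with constant `c`. -/
def Covers (s ν : ℝ) (φ : ℝ → ℝ) (c : ℝ) : Prop :=
  0 < c ∧ ∀ t ∈ Set.Ioc 0 s, ∀ σ ∈ Set.Icc t s, c * (t ^ ν / φ t) ≤ σ ^ ν / φ σ

end Regularization

section Scalar

variable {X : Type*} (H : Type*) [NormedAddCommGroup H] [InnerProductSpace ℝ H] [CompleteSpace H]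
  [RKHS ℝ H X ℝ]

/-- The reproducing kernel `k(x, t)` of the scalar RKHS `H`. -/
def scalarKernel (x t : X) : ℝ := RKHS.kernel H x t 1

/-- The feature map `x ↦ k(x, ·) ∈ H`. -/
def feature (x : X) : H := RKHS.kerFun H x 1

/-- The covariance operator `C_X = 𝔼_q [feature x ⊗ feature x]`. -/
def covOp [MeasurableSpace X] (qX : Measure X) : H →L[ℝ] H :=
  ∫ x, InnerProductSpace.rankOne ℝ (feature H x) (feature H x) ∂qX

end Scalar

section Estimator

variable {X Y : Type*} [NormedAddCommGroup Y] [InnerProductSpace ℝ Y] [CompleteSpace Y]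
  (G : Type*) [NormedAddCommGroup G] [InnerProductSpace ℝ G] [CompleteSpace G] [RKHS ℝ G X Y]
  {n : ℕ}

/-- The sampling operator `S f = (f (x₁), …, f (xₙ))`. -/
def samplingOp (x : Fin n → X) : G →L[ℝ] (Fin n → Y) :=
  ContinuousLinearMap.pi fun i => (RKHS.kerFun G (x i)).adjoint

/-- `S* y = (1/n) ∑ᵢ K_{xᵢ} yᵢ`, the adjoint of `S` for `‖y‖ₙ² = (1/n) ∑ᵢ ‖yᵢ‖²`. -/
def samplingAdj (x : Fin n → X) : (Fin n → Y) →L[ℝ] G :=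
  (n : ℝ)⁻¹ • ∑ i, RKHS.kerFun G (x i) ∘L ContinuousLinearMap.proj i

/-- The diagonal operator `diag (w₁, …, wₙ)` on `Yⁿ`. -/
def diagOp (w : Fin n → ℝ) : (Fin n → Y) →L[ℝ] (Fin n → Y) :=
  ContinuousLinearMap.pi fun i => w i • ContinuousLinearMap.proj i

/-- The importance weighted estimator `g_lam (S* 𝓑 S) S* 𝓑 y` of the sample
`z = ((x₁, y₁), …, (xₙ, yₙ))`, where `gl = g_lam` and `𝓑 = diag (β (x₁), …, β (xₙ))`. -/
def estimator (β : X → ℝ) (gl : ℝ → ℝ) (z : Fin n → X × Y) : G :=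
  let S := samplingOp G fun i => (z i).1
  let Sadj := samplingAdj G fun i => (z i).1
  let W : (Fin n → Y) →L[ℝ] (Fin n → Y) := diagOp fun i => β (z i).1
  funcCalc (Sadj ∘L W ∘L S) gl (Sadj (W fun i => (z i).2))

end Estimator

end CovShift

end

/-!
The map `k(x, ·) ⊗ y ↦ K_x y` identifies `G` with the Hilbert–Schmidt operators from `H` to `Y`,
and `f* - f̂` with `C_* (1 - Ĉ g(Ĉ)) - (Ĉ_{xy} - C_* Ĉ) g(Ĉ)`, where `Ĉ` and `Ĉ_{xy}` are the
reweighted empirical covariance and cross covariance operators. The condition on `λ` makes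
`‖(C + λ)^{-1/2} (Ĉ - C)‖` at most `√λ / 2` with high probability, and then the resolvents of `C`
and `Ĉ` are comparable up to a factor `2`.

In the first term, the covering property trades `φ(C)` for `φ(λ) λ^{-ν} (C + λ)^ν`, and `(C + λ)^ν`
has to be compared with `(Ĉ + λ)^ν`. The Heinz inequality does this only for exponents up to one, so
`⌊ν⌋` integer powers are exchanged by telescoping, each at the cost of one deviation of `Ĉ` from
`C`; hence the factor `⌊ν⌋` in `A₁` and `A₂`. The second term is a centered empirical sum, because
`f*` is the regression function and `β` transports `p_X` to `q_X`.

Pinelis' inequality bounds both deviations, as norms of sums of independent elementary tensors,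
unless `δ` is close to `1`, where Chebyshev's inequality is better. With the thresholds
`2 log (2 / δ)` and `√5 log (2 / δ)` the two failure probabilities add up to at most `δ`; this is
the origin of the constant `√10 = √2 √5`.
-/

namespace CovShift

section Bases

variable {E F ι : Type*} [NormedAddCommGroup E] [InnerProductSpace ℝ E]
  [NormedAddCommGroup F] [InnerProductSpace ℝ F]

theorem hasSum_inner_sq (e : HilbertBasis ι ℝ E) (v : E) :
    HasSum (fun i => ⟪e i, v⟫ ^ 2) (‖v‖ ^ 2) := by
  simpa only [real_inner_self_eq_norm_sq, real_inner_comm, ← sq]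
    using e.hasSum_inner_mul_inner v v

theorem hasSum_inner_smul (e : HilbertBasis ι ℝ E) (v : E) :
    HasSum (fun i => ⟪e i, v⟫ • e i) v := by
  simpa only [HilbertBasis.repr_apply_apply] using e.hasSum_repr v

theorem ext_inner_basis (e : HilbertBasis ι ℝ E) {v w : E} (h : ∀ i, ⟪e i, v⟫ = ⟪e i, w⟫) :
    v = w :=
  e.repr.injective <| lp.ext <| funext fun i => by simpa only [e.repr_apply_apply] using h i

theorem ext_basis (e : HilbertBasis ι ℝ E) {S T : E →L[ℝ] F} (h : ∀ i, S (e i) = T (e i)) :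
    S = T :=
  ContinuousLinearMap.ext_on (dense_iff_closure_eq.mpr <| by
    rw [← Submodule.topologicalClosure_coe, e.dense_span, Submodule.top_coe])
    (by rintro _ ⟨i, rfl⟩; exact h i)

theorem norm_basis_sub_basis_sq (e : HilbertBasis ι ℝ E) {i j : ι} (hij : i ≠ j) :
    ‖e i - e j‖ ^ 2 = 2 := by
  rw [norm_sub_sq_real, e.orthonormal.2 hij, e.orthonormal.1, e.orthonormal.1]
  norm_num

theorem countable_of_hilbertBasis [TopologicalSpace.SeparableSpace E] (e : HilbertBasis ι ℝ E) :
    Countable ι := by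
  refine Pairwise.countable_of_isOpen_disjoint (s := fun i => Metric.ball (e i) (1 / 2)) ?_
    (fun i => Metric.isOpen_ball) (fun i => ⟨e i, Metric.mem_ball_self (by norm_num)⟩)
  intro i j hij
  refine Metric.ball_disjoint_ball ?_
  have h := norm_basis_sub_basis_sq e hij
  rw [dist_eq_norm]
  nlinarith [norm_nonneg (e i - e j)]

end Bases

section FuncCalc

variable {E ι : Type*} [NormedAddCommGroup E] [InnerProductSpace ℝ E] [CompleteSpace E]
  {T : E →L[ℝ] E}

theorem starProjection_ker_sub_smul (hT : (T : E →ₗ[ℝ] E).IsSymmetric) {μ : ℝ} {x : E}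
    (hx : T x = μ • x) (ξ : ℝ) :
    (T - ξ • ContinuousLinearMap.id ℝ E).ker.starProjection x = if μ = ξ then x else 0 := by
  split_ifs with hμ
  · refine Submodule.starProjection_eq_self_iff.mpr ?_
    simp [hx, hμ]
  · rw [Submodule.starProjection_apply_eq_zero_iff, Submodule.mem_orthogonal]
    intro u hu
    have hTu : T u = ξ • u := sub_eq_zero.mp (by simpa using hu)
    have hsymm := hT u x
    rw [ContinuousLinearMap.coe_coe, hTu, hx, real_inner_smul_left, real_inner_smul_right] at hsymm
    exact (mul_eq_mul_right_iff.mp hsymm).resolve_left (Ne.symm hμ)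

theorem funcCalc_eq_of_hasSum (hT : (T : E →ₗ[ℝ] E).IsSymmetric) (f : ℝ → ℝ) {x : ι → E}
    {μ : ι → ℝ} (hx : ∀ i, T (x i) = μ i • x i) {v w : E} (hv : HasSum x v)
    (hw : HasSum (fun i => f (μ i) • x i) w) : funcCalc T f v = w := by
  refine Eq.trans (tsum_congr fun ξ => ?_) (hw.tsum_fiberwise μ).tsum_eq
  rw [tsum_subtype (μ ⁻¹' {ξ}) fun i => f (μ i) • x i,
    ← (((T - ξ • ContinuousLinearMap.id ℝ E).ker.starProjection.hasSum hv).const_smul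
      (f ξ)).tsum_eq]
  refine tsum_congr fun i => ?_
  rw [starProjection_ker_sub_smul hT (hx i)]
  by_cases hξ : μ i = ξ <;> simp [hξ]

theorem funcCalc_congr_of_starProjection_ker_eq_zero {f f' : ℝ → ℝ} {v : E}
    (hf : Set.EqOn f f' {0}ᶜ) (hv : T.ker.starProjection v = 0) :
    funcCalc T f v = funcCalc T f' v := by
  refine tsum_congr fun μ => ?_
  rcases eq_or_ne μ 0 with rfl | hμ
  · have hker : (T - (0 : ℝ) • ContinuousLinearMap.id ℝ E).ker.starProjection v = 0 := by
      simpa only [zero_smul, sub_zero] using hv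
    rw [hker, smul_zero, smul_zero]
  · rw [hf hμ]

end FuncCalc

section PosEigenbasis

variable {E F ι : Type*} [NormedAddCommGroup E] [InnerProductSpace ℝ E]
  [NormedAddCommGroup F] [InnerProductSpace ℝ F] {T : E →L[ℝ] E}

/-- An orthonormal basis of eigenvectors of `T` with nonnegative eigenvalues. It exists for every
compact positive operator and carries the functional calculus `f(T)`. -/
structure PosEigenbasis (ι : Type*) (T : E →L[ℝ] E) where
  /-- The eigenvectors. -/
  basis : HilbertBasis ι ℝ E
  /-- The eigenvalues, repeated according to multiplicity. -/
  eigenvalue : ι → ℝ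
  eigenvalue_nonneg (i : ι) : 0 ≤ eigenvalue i
  apply_basis (i : ι) : T (basis i) = eigenvalue i • basis i

theorem exists_hilbertBasis_mem_of_orthogonalFamily.{u, v} {E : Type u} [NormedAddCommGroup E]
    [InnerProductSpace ℝ E] [CompleteSpace E] {κ : Type v} (V : κ → Submodule ℝ E)
    [∀ μ, CompleteSpace (V μ)] (hV : OrthogonalFamily ℝ (fun μ => V μ) fun μ => (V μ).subtypeₗᵢ)
    (hbot : (⨆ μ, V μ)ᗮ = ⊥) :
    ∃ (ι : Type (max v u)) (e : HilbertBasis ι ℝ E) (p : ι → κ), ∀ i, e i ∈ V (p i) := by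
  have horth := hV.orthonormal_sigma_orthonormal (v_family := fun μ i => onb (V μ) i)
    fun μ => (onb (V μ)).orthonormal
  refine ⟨Σ μ, basisIndex (V μ), HilbertBasis.mkOfOrthogonalEqBot horth ?_, Sigma.fst,
    fun q => ?_⟩
  · rw [Submodule.eq_bot_iff]
    intro v hv
    rw [← Submodule.mem_bot ℝ, ← hbot, ← Submodule.iInf_orthogonal, Submodule.mem_iInf]
    intro μ
    rw [Submodule.mem_orthogonal]
    have hzero : ((innerSL ℝ v) ∘L (V μ).subtypeL) = 0 := ext_basis (onb (V μ)) fun i => by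
      simpa using (Submodule.mem_orthogonal' _ _).mp hv _ (Submodule.subset_span ⟨⟨μ, i⟩, rfl⟩)
    intro x hx
    rw [real_inner_comm]
    exact DFunLike.congr_fun hzero ⟨x, hx⟩
  · rw [HilbertBasis.coe_mkOfOrthogonalEqBot]
    exact (onb (V q.1) q.2).2

theorem exists_posEigenbasis.{u} {E : Type u} [NormedAddCommGroup E] [InnerProductSpace ℝ E]
    [CompleteSpace E] {T : E →L[ℝ] E} (hcomp : IsCompactOperator T) (hpos : T.IsPositive) :
    ∃ ι : Type u, Nonempty (PosEigenbasis ι T) := by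
  have hsymm := hpos.isSymmetric
  have (μ : ℝ) : CompleteSpace (Module.End.eigenspace (T : E →ₗ[ℝ] E) μ) := by
    have hker : Module.End.eigenspace (T : E →ₗ[ℝ] E) μ
        = (T - μ • ContinuousLinearMap.id ℝ E).ker := by
      ext v
      simp [sub_eq_zero]
    rw [hker]
    exact (ContinuousLinearMap.isClosed_ker _).completeSpace_coe
  obtain ⟨ι, e, μ, he⟩ := exists_hilbertBasis_mem_of_orthogonalFamily _
    hsymm.orthogonalFamily_eigenspaces
    (ContinuousLinearMap.orthogonalComplement_iSup_eigenspaces_eq_bot hcomp hsymm)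
  have hTe (i : ι) : T (e i) = μ i • e i := Module.End.mem_eigenspace_iff.mp (he i)
  refine ⟨ι, ⟨e, μ, fun i => ?_, hTe⟩⟩
  have h := hpos.inner_nonneg_left (e i)
  rwa [hTe, real_inner_smul_left, real_inner_self_eq_norm_sq, e.orthonormal.1, one_pow,
    mul_one] at h

namespace PosEigenbasis

variable (d : PosEigenbasis ι T) {f g k : ℝ → ℝ}

/-- The function `f` is bounded on the eigenvalues of `T`, so that `f(T)` is a bounded operator. -/
def Bdd (f : ℝ → ℝ) : Prop := ∃ K, ∀ i, |f (d.eigenvalue i)| ≤ K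

open Classical in
/-- The functional calculus `f(T) = ∑ᵢ f(λᵢ) eᵢ ⊗ eᵢ`, with the convention that `f(T) = 0` when `f`
is unbounded on the eigenvalues. -/
noncomputable def func (f : ℝ → ℝ) : E →L[ℝ] E :=
  if hf : d.Bdd f then
    (d.basis.repr.symm : _ →L[ℝ] E) ∘L
      lp.mapCLM 2 (fun i => f (d.eigenvalue i) • ContinuousLinearMap.id ℝ ℝ)
        (abs_nonneg hf.choose) (fun i => (norm_smul_le _ _).trans <| by
          simpa using (hf.choose_spec i).trans (le_abs_self _)) ∘L
      (d.basis.repr : E →L[ℝ] _)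
  else 0

variable {d}

theorem inner_basis_func (hf : d.Bdd f) (i : ι) (v : E) :
    ⟪d.basis i, d.func f v⟫ = f (d.eigenvalue i) * ⟪d.basis i, v⟫ := by
  rw [func, dif_pos hf, ← HilbertBasis.repr_apply_apply, ← HilbertBasis.repr_apply_apply]
  simp

theorem func_apply_basis (hf : d.Bdd f) (i : ι) :
    d.func f (d.basis i) = f (d.eigenvalue i) • d.basis i := by
  classical
  refine ext_inner_basis d.basis fun j => ?_
  rw [inner_basis_func hf, real_inner_smul_right, orthonormal_iff_ite.mp d.basis.orthonormal]
  split_ifs with hij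
  · rw [hij]
  · simp only [mul_zero]

theorem hasSum_func_apply (hf : d.Bdd f) (v : E) :
    HasSum (fun i => f (d.eigenvalue i) • ⟪d.basis i, v⟫ • d.basis i) (d.func f v) := by
  simpa only [inner_basis_func hf, mul_smul] using hasSum_inner_smul d.basis (d.func f v)

theorem hasSum_norm_func_sq (hf : d.Bdd f) (v : E) :
    HasSum (fun i => f (d.eigenvalue i) ^ 2 * ⟪d.basis i, v⟫ ^ 2) (‖d.func f v‖ ^ 2) := by
  simpa only [inner_basis_func hf, mul_pow] using hasSum_inner_sq d.basis (d.func f v)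

theorem norm_func_le {K : ℝ} (hK : 0 ≤ K) (hf : ∀ i, |f (d.eigenvalue i)| ≤ K) :
    ‖d.func f‖ ≤ K := by
  refine ContinuousLinearMap.opNorm_le_bound _ hK fun v => ?_
  refine (sq_le_sq₀ (norm_nonneg _) (by positivity)).mp ?_
  rw [mul_pow]
  refine hasSum_le (fun i => ?_) (hasSum_norm_func_sq ⟨K, hf⟩ v)
    ((hasSum_inner_sq d.basis v).mul_left (K ^ 2))
  exact mul_le_mul_of_nonneg_right (sq_le_sq.mpr ((hf i).trans (le_abs_self K))) (sq_nonneg _)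

theorem inner_func_left (hf : d.Bdd f) (v w : E) : ⟪d.func f v, w⟫ = ⟪v, d.func f w⟫ := by
  refine (d.basis.hasSum_inner_mul_inner _ w).unique ?_
  convert! d.basis.hasSum_inner_mul_inner v (d.func f w) using 2 with i
  rw [inner_basis_func hf, real_inner_comm, inner_basis_func hf, real_inner_comm v]
  ring

theorem Bdd.mul (hf : d.Bdd f) (hg : d.Bdd g) : d.Bdd fun t => f t * g t := by
  obtain ⟨K, hK⟩ := hf
  obtain ⟨L, hL⟩ := hg
  refine ⟨K * L, fun i => ?_⟩
  rw [abs_mul]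
  exact mul_le_mul (hK i) (hL i) (abs_nonneg _) ((abs_nonneg _).trans (hK i))

theorem func_mul_func (hf : d.Bdd f) (hg : d.Bdd g) (hk : ∀ t, 0 ≤ t → f t * g t = k t) :
    d.func f * d.func g = d.func k := by
  have hfg (i : ι) := hk _ (d.eigenvalue_nonneg i)
  have hbk : d.Bdd k := by
    obtain ⟨K, hK⟩ := hf.mul hg
    exact ⟨K, fun i => hfg i ▸ hK i⟩
  refine ext_basis d.basis fun i => ?_
  rw [ContinuousLinearMap.mul_def, ContinuousLinearMap.comp_apply, func_apply_basis hg, map_smul,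
    func_apply_basis hf, func_apply_basis hbk, smul_smul, mul_comm, hfg]

theorem eigenvalue_le_norm (d : PosEigenbasis ι T) (i : ι) : d.eigenvalue i ≤ ‖T‖ := by
  have h := T.le_opNorm (d.basis i)
  rw [d.apply_basis, norm_smul, d.basis.orthonormal.1, mul_one, mul_one] at h
  exact (Real.le_norm_self _).trans h

theorem bdd_of_continuousOn (d : PosEigenbasis ι T) (hf : ContinuousOn f (Set.Ici 0)) :
    d.Bdd f := by
  obtain ⟨K, hK⟩ := (isCompact_Icc (a := 0) (b := ‖T‖)).exists_bound_of_continuousOn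
    (hf.mono Set.Icc_subset_Ici_self)
  exact ⟨K, fun i => hK _ ⟨d.eigenvalue_nonneg i, d.eigenvalue_le_norm i⟩⟩

theorem func_id (d : PosEigenbasis ι T) : d.func id = T :=
  ext_basis d.basis fun i => by
    rw [func_apply_basis (d.bdd_of_continuousOn continuousOn_id), d.apply_basis, id]

theorem func_one (d : PosEigenbasis ι T) : d.func (fun _ => 1) = 1 :=
  ext_basis d.basis fun i => by
    rw [func_apply_basis ⟨1, fun _ => by simp⟩, one_smul, one_apply_eq_self]

theorem isSymmetric (d : PosEigenbasis ι T) (v w : E) : ⟪T v, w⟫ = ⟪v, T w⟫ := by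
  simpa only [d.func_id] using inner_func_left (d.bdd_of_continuousOn continuousOn_id) v w

theorem funcCalc_eq_func [CompleteSpace E] (hf : d.Bdd f) (v : E) :
    funcCalc T f v = d.func f v :=
  funcCalc_eq_of_hasSum (fun v w => d.isSymmetric v w) f
    (fun i => by rw [map_smul, d.apply_basis, smul_comm]) (hasSum_inner_smul d.basis v)
    (hasSum_func_apply hf v)

variable (d)

/-- The power `(T + lam)^r`. -/
noncomputable def shiftPow (lam r : ℝ) : E →L[ℝ] E := d.func fun t => (t + lam) ^ r

variable {lam : ℝ}

theorem bdd_shiftPow (hlam : 0 < lam) (r : ℝ) : d.Bdd fun t => (t + lam) ^ r :=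
  d.bdd_of_continuousOn <| (continuousOn_id.add continuousOn_const).rpow_const fun _ ht =>
    Or.inl (add_pos_of_nonneg_of_pos ht hlam).ne'

theorem shiftPow_mul_shiftPow (hlam : 0 < lam) (r r' : ℝ) :
    d.shiftPow lam r * d.shiftPow lam r' = d.shiftPow lam (r + r') :=
  func_mul_func (d.bdd_shiftPow hlam r) (d.bdd_shiftPow hlam r') fun _ ht =>
    (Real.rpow_add (add_pos_of_nonneg_of_pos ht hlam) r r').symm

theorem shiftPow_zero (lam : ℝ) : d.shiftPow lam 0 = 1 := by
  simp only [shiftPow, Real.rpow_zero, d.func_one]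

theorem shiftPow_one (hlam : 0 < lam) : d.shiftPow lam 1 = T + lam • 1 :=
  ext_basis d.basis fun i => by
    rw [shiftPow, func_apply_basis (d.bdd_shiftPow hlam 1), Real.rpow_one]
    simp [d.apply_basis, add_smul]

theorem shiftPow_mul_shiftPow_neg (hlam : 0 < lam) (r : ℝ) :
    d.shiftPow lam r * d.shiftPow lam (-r) = 1 := by
  rw [d.shiftPow_mul_shiftPow hlam, add_neg_cancel, d.shiftPow_zero]

theorem shiftPow_neg_mul_shiftPow (hlam : 0 < lam) (r : ℝ) :
    d.shiftPow lam (-r) * d.shiftPow lam r = 1 := by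
  rw [d.shiftPow_mul_shiftPow hlam, neg_add_cancel, d.shiftPow_zero]

theorem shiftPow_pow (hlam : 0 < lam) (r : ℝ) (m : ℕ) :
    d.shiftPow lam r ^ m = d.shiftPow lam (m * r) := by
  induction m with
  | zero => rw [pow_zero, Nat.cast_zero, zero_mul, d.shiftPow_zero]
  | succ m ih => rw [pow_succ, ih, d.shiftPow_mul_shiftPow hlam]; push_cast; ring_nf

theorem norm_shiftPow_le (hlam : 0 < lam) {r : ℝ} (hr : r ≤ 0) :
    ‖d.shiftPow lam r‖ ≤ lam ^ r := by
  refine norm_func_le (Real.rpow_nonneg hlam.le r) fun i => ?_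
  have h := d.eigenvalue_nonneg i
  rw [abs_of_nonneg (by positivity)]
  exact Real.rpow_le_rpow_of_nonpos hlam (by linarith) hr

end PosEigenbasis

end PosEigenbasis

section Heinz

open Real in
theorem lintegral_rpowIntegrand {r x : ℝ} (hr : r ∈ Set.Ioo 0 1) (hx : 0 ≤ x) :
    ∫⁻ t in Set.Ioi 0, ENNReal.ofReal (rpowIntegrand₀₁ r t x)
      = ENNReal.ofReal (∫ t in Set.Ioi 0, rpowIntegrand₀₁ r t 1) * ENNReal.ofReal (x ^ r) := by
  rw [← ofReal_integral_eq_lintegral_ofReal (integrableOn_rpowIntegrand₀₁_Ioi hr hx),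
    integral_rpowIntegrand₀₁_eq_rpow_mul_const hr hx, mul_comm,
    ENNReal.ofReal_mul (integral_rpowIntegrand₀₁_one_pos hr).le]
  exact ae_restrict_of_forall_mem measurableSet_Ioi fun t ht =>
    rpowIntegrand₀₁_nonneg hr.1 (le_of_lt ht) hx

namespace PosEigenbasis

variable {E ι ι' : Type*} [NormedAddCommGroup E] [InnerProductSpace ℝ E] {S T : E →L[ℝ] E}
  (d : PosEigenbasis ι T)

/-- The quadratic `K`-functional `inf_w (‖v - w‖² + ‖T w‖² / t)`, as the quadratic form of
`T² (t + T²)⁻¹`. -/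
noncomputable def kFunctional (t : ℝ) (v : E) : ℝ :=
  ‖d.func (fun x => √(x ^ 2 / (t + x ^ 2))) v‖ ^ 2

variable {t : ℝ}

theorem bdd_sqrt_sq_div (ht : 0 < t) : d.Bdd fun x => √(x ^ 2 / (t + x ^ 2)) :=
  d.bdd_of_continuousOn <| by
    have : ∀ x ∈ Set.Ici (0 : ℝ), t + x ^ 2 ≠ 0 := fun x _ => by positivity
    fun_prop (disch := assumption)

theorem hasSum_kFunctional (ht : 0 < t) (v : E) :
    HasSum (fun i => d.eigenvalue i ^ 2 / (t + d.eigenvalue i ^ 2) * ⟪d.basis i, v⟫ ^ 2)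
      (d.kFunctional t v) := by
  convert! hasSum_norm_func_sq (d.bdd_sqrt_sq_div ht) v using 3
  rw [Real.sq_sqrt (by positivity)]

theorem hasSum_norm_apply_sq (v : E) :
    HasSum (fun i => d.eigenvalue i ^ 2 * ⟪d.basis i, v⟫ ^ 2) (‖T v‖ ^ 2) := by
  simpa only [d.func_id, id]
    using hasSum_norm_func_sq (d.bdd_of_continuousOn continuousOn_id) v

theorem kFunctional_le (ht : 0 < t) (v w : E) :
    d.kFunctional t v ≤ ‖v - w‖ ^ 2 + t⁻¹ * ‖T w‖ ^ 2 := by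
  refine hasSum_le (fun i => ?_) (d.hasSum_kFunctional ht v)
    ((hasSum_inner_sq d.basis (v - w)).add ((d.hasSum_norm_apply_sq w).mul_left t⁻¹))
  rw [inner_sub_right, ← sub_nonneg]
  set a := d.eigenvalue i
  set x := ⟪d.basis i, v⟫
  set y := ⟪d.basis i, w⟫
  have hsquare : (x - y) ^ 2 + t⁻¹ * (a ^ 2 * y ^ 2) - a ^ 2 / (t + a ^ 2) * x ^ 2
      = (t * x - (t + a ^ 2) * y) ^ 2 / (t * (t + a ^ 2)) := by
    have : t + a ^ 2 ≠ 0 := by positivity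
    field_simp
    ring
  rw [hsquare]
  positivity

theorem exists_kFunctional_eq (ht : 0 < t) (v : E) :
    ∃ w, d.kFunctional t v = ‖v - w‖ ^ 2 + t⁻¹ * ‖T w‖ ^ 2 := by
  have hb : d.Bdd fun x => t / (t + x ^ 2) := d.bdd_of_continuousOn <| by
    have : ∀ x ∈ Set.Ici (0 : ℝ), t + x ^ 2 ≠ 0 := fun x _ => by positivity
    fun_prop (disch := assumption)
  refine ⟨d.func (fun x => t / (t + x ^ 2)) v, (d.hasSum_kFunctional ht v).unique ?_⟩
  convert! (hasSum_inner_sq d.basis _).add ((d.hasSum_norm_apply_sq _).mul_left t⁻¹) using 2 with i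
  rw [inner_sub_right, inner_basis_func hb]
  have : t + d.eigenvalue i ^ 2 ≠ 0 := by positivity
  field_simp
  ring

theorem kFunctional_le_kFunctional (d' : PosEigenbasis ι' S) (h : ∀ v, ‖T v‖ ≤ ‖S v‖) (ht : 0 < t)
    (v : E) : d.kFunctional t v ≤ d'.kFunctional t v := by
  obtain ⟨w, hw⟩ := d'.exists_kFunctional_eq ht v
  rw [hw]
  refine (d.kFunctional_le ht v w).trans ?_
  gcongr
  exact h w

theorem bdd_rpow {r : ℝ} (hr : 0 ≤ r) : d.Bdd fun t => t ^ r :=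
  d.bdd_of_continuousOn (Real.continuous_rpow_const hr).continuousOn

open Real in
theorem lintegral_kFunctional [Countable ι] {r : ℝ} (hr : r ∈ Set.Ioo 0 1) (v : E) :
    ∫⁻ t in Set.Ioi 0, ENNReal.ofReal (t ^ (r - 1) * d.kFunctional t v)
      = ENNReal.ofReal (∫ t in Set.Ioi 0, rpowIntegrand₀₁ r t 1) *
        ENNReal.ofReal (‖d.func (fun t => t ^ r) v‖ ^ 2) := by
  have hnorm := hasSum_norm_func_sq (d.bdd_rpow hr.1.le) v
  have hintegrand : ∀ t ∈ Set.Ioi (0 : ℝ), ENNReal.ofReal (t ^ (r - 1) * d.kFunctional t v)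
      = ∑' i, ENNReal.ofReal (rpowIntegrand₀₁ r t (d.eigenvalue i ^ 2)) *
        ENNReal.ofReal (⟪d.basis i, v⟫ ^ 2) := by
    intro t (ht : 0 < t)
    have hsum := (d.hasSum_kFunctional ht v).mul_left (t ^ (r - 1))
    rw [← hsum.tsum_eq, ENNReal.ofReal_tsum_of_nonneg (fun i => by positivity) hsum.summable]
    refine tsum_congr fun i => ?_
    rw [← mul_assoc, ENNReal.ofReal_mul (by positivity),
      rpowIntegrand₀₁_eq_pow_div hr ht.le (sq_nonneg _), mul_div_assoc]
  rw [setLIntegral_congr_fun measurableSet_Ioi hintegrand, lintegral_tsum fun i =>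
      (aestronglyMeasurable_rpowIntegrand₀₁ hr
        (sq_nonneg _)).aemeasurable.ennreal_ofReal.mul_const _,
    ← hnorm.tsum_eq, ENNReal.ofReal_tsum_of_nonneg (fun i => by positivity) hnorm.summable,
    ← ENNReal.tsum_mul_left]
  refine tsum_congr fun i => ?_
  rw [lintegral_mul_const' _ _ ENNReal.ofReal_ne_top, lintegral_rpowIntegrand hr (sq_nonneg _),
    mul_assoc, ← ENNReal.ofReal_mul (rpow_nonneg (sq_nonneg _) r),
    ← rpow_pow_comm (d.eigenvalue_nonneg i)]

theorem norm_func_rpow_le_of_norm_le [Countable ι] [Countable ι'] (d' : PosEigenbasis ι' S)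
    (h : ∀ v, ‖T v‖ ≤ ‖S v‖) {r : ℝ} (hr : r ∈ Set.Ioo 0 1) (v : E) :
    ‖d.func (fun t => t ^ r) v‖ ≤ ‖d'.func (fun t => t ^ r) v‖ := by
  have hlintegral := setLIntegral_mono' (μ := volume) measurableSet_Ioi fun t (ht : 0 < t) =>
    ENNReal.ofReal_le_ofReal (mul_le_mul_of_nonneg_left (d.kFunctional_le_kFunctional d' h ht v)
      (Real.rpow_nonneg ht.le (r - 1)))
  rw [d.lintegral_kFunctional hr, d'.lintegral_kFunctional hr,
    ENNReal.mul_le_mul_iff_right (by simpa using Real.integral_rpowIntegrand₀₁_one_pos hr)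
      ENNReal.ofReal_ne_top, ENNReal.ofReal_le_ofReal_iff (by positivity)] at hlintegral
  exact (sq_le_sq₀ (norm_nonneg _) (norm_nonneg _)).mp hlintegral

/-- The eigenbasis of `c • T`. -/
def constSMul {c : ℝ} (hc : 0 ≤ c) : PosEigenbasis ι (c • T) where
  basis := d.basis
  eigenvalue i := c * d.eigenvalue i
  eigenvalue_nonneg i := mul_nonneg hc (d.eigenvalue_nonneg i)
  apply_basis i := by rw [smul_apply, d.apply_basis, smul_smul]

theorem func_rpow_constSMul {c : ℝ} (hc : 0 ≤ c) {r : ℝ} (hr : 0 ≤ r) :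
    (d.constSMul hc).func (fun t => t ^ r) = c ^ r • d.func fun t => t ^ r :=
  ext_basis d.basis fun i => by
    have h := func_apply_basis ((d.constSMul hc).bdd_rpow hr) i
    rw [smul_apply, func_apply_basis (d.bdd_rpow hr), smul_smul,
      ← Real.mul_rpow hc (d.eigenvalue_nonneg i)]
    exact h

/-- The eigenbasis of `T + lam`. -/
def shift {lam : ℝ} (hlam : 0 ≤ lam) : PosEigenbasis ι (T + lam • 1) where
  basis := d.basis
  eigenvalue i := d.eigenvalue i + lam
  eigenvalue_nonneg i := add_nonneg (d.eigenvalue_nonneg i) hlam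
  apply_basis i := by simp [d.apply_basis, add_smul]

theorem norm_shiftPow_apply_le [Countable ι] [Countable ι'] (d' : PosEigenbasis ι' S) {lam c : ℝ}
    (hlam : 0 ≤ lam) (hc : 0 ≤ c)
    (h : ∀ v, ‖(T + lam • 1 : E →L[ℝ] E) v‖ ≤ c * ‖(S + lam • 1 : E →L[ℝ] E) v‖) {r : ℝ}
    (hr : r ∈ Set.Ioo 0 1) (v : E) :
    ‖d.shiftPow lam r v‖ ≤ c ^ r * ‖d'.shiftPow lam r v‖ := by
  have hheinz := (d.shift hlam).norm_func_rpow_le_of_norm_le ((d'.shift hlam).constSMul hc)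
    (fun v => (h v).trans_eq (by
      rw [smul_apply, norm_smul, Real.norm_of_nonneg hc])) hr v
  rwa [func_rpow_constSMul _ hc hr.1.le, smul_apply, norm_smul,
    Real.norm_of_nonneg (Real.rpow_nonneg hc r)] at hheinz

end PosEigenbasis

end Heinz

section HilbertSchmidt

variable {E F E' ι ι' : Type*} [NormedAddCommGroup E] [InnerProductSpace ℝ E] [CompleteSpace E]
  [NormedAddCommGroup F] [InnerProductSpace ℝ F]
  [NormedAddCommGroup E'] [InnerProductSpace ℝ E']
  {S T : E →L[ℝ] F}

omit [CompleteSpace E] in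
theorem tsum_enorm_inner_sq (e : HilbertBasis ι ℝ E) (v : E) :
    ∑' i, ‖⟪e i, v⟫‖ₑ ^ 2 = ‖v‖ₑ ^ 2 := by
  have hsum := hasSum_inner_sq e v
  rw [← ofReal_norm v, ← ENNReal.ofReal_pow (norm_nonneg v), ← hsum.tsum_eq]
  simp_rw [← ofReal_norm, ← ENNReal.ofReal_pow (norm_nonneg _), Real.norm_eq_abs, sq_abs]
  rw [ENNReal.ofReal_tsum_of_nonneg (fun i => sq_nonneg _) hsum.summable]

theorem tsum_enorm_sq_adjoint [CompleteSpace F] (e : HilbertBasis ι ℝ E) (f : HilbertBasis ι' ℝ F)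
    (T : E →L[ℝ] F) : ∑' j, ‖T.adjoint (f j)‖ₑ ^ 2 = ∑' i, ‖T (e i)‖ₑ ^ 2 := by
  simp_rw [← tsum_enorm_inner_sq f, ← tsum_enorm_inner_sq e]
  rw [ENNReal.tsum_comm]
  simp_rw [ContinuousLinearMap.adjoint_inner_right, real_inner_comm]

theorem tsum_enorm_sq_basis [CompleteSpace F] (e : HilbertBasis ι ℝ E) (e' : HilbertBasis ι' ℝ E)
    (T : E →L[ℝ] F) : ∑' i, ‖T (e i)‖ₑ ^ 2 = ∑' j, ‖T (e' j)‖ₑ ^ 2 := by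
  rw [← tsum_enorm_sq_adjoint e (onb F), ← tsum_enorm_sq_adjoint e' (onb F)]

theorem hsNorm_nonneg (T : E →L[ℝ] F) : 0 ≤ hsNorm T := Real.sqrt_nonneg _

theorem hsNorm_sq (T : E →L[ℝ] F) : hsNorm T ^ 2 = ∑' i, ‖T (onb E i)‖ ^ 2 :=
  Real.sq_sqrt (tsum_nonneg fun _ => sq_nonneg _)

theorem IsHilbertSchmidt.tsum_enorm_sq (hT : IsHilbertSchmidt T) :
    ∑' i, ‖T (onb E i)‖ₑ ^ 2 = ENNReal.ofReal (hsNorm T ^ 2) := by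
  rw [hsNorm_sq, ENNReal.ofReal_tsum_of_nonneg (fun _ => sq_nonneg _) hT]
  simp only [← ofReal_norm, ENNReal.ofReal_pow (norm_nonneg _)]

omit [InnerProductSpace ℝ F] in
theorem summable_norm_sq_of_tsum_enorm_sq {v : ι → F} (h : ∑' i, ‖v i‖ₑ ^ 2 ≠ ⊤) :
    Summable fun i => ‖v i‖ ^ 2 := by
  simpa using ENNReal.summable_toReal h

theorem isHilbertSchmidt_of_tsum_enorm_sq_le {B : ℝ} (hB : 0 ≤ B)
    (h : ∑' i, ‖T (onb E i)‖ₑ ^ 2 ≤ ENNReal.ofReal (B ^ 2)) :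
    IsHilbertSchmidt T ∧ hsNorm T ≤ B := by
  have hT : IsHilbertSchmidt T :=
    summable_norm_sq_of_tsum_enorm_sq (ne_top_of_le_ne_top ENNReal.ofReal_ne_top h)
  refine ⟨hT, (sq_le_sq₀ (hsNorm_nonneg T) hB).mp ?_⟩
  rwa [hT.tsum_enorm_sq, ENNReal.ofReal_le_ofReal_iff (sq_nonneg B)] at h

theorem IsHilbertSchmidt.hasSum_norm_sq [CompleteSpace F] (hT : IsHilbertSchmidt T)
    (e : HilbertBasis ι ℝ E) : HasSum (fun i => ‖T (e i)‖ ^ 2) (hsNorm T ^ 2) := by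
  have htsum : ∑' i, ‖T (e i)‖ₑ ^ 2 = ENNReal.ofReal (hsNorm T ^ 2) := by
    rw [tsum_enorm_sq_basis e (onb E), hT.tsum_enorm_sq]
  have hsum : Summable fun i => ‖T (e i)‖ ^ 2 :=
    summable_norm_sq_of_tsum_enorm_sq (htsum ▸ ENNReal.ofReal_ne_top)
  convert hsum.hasSum
  rw [← ENNReal.toReal_ofReal (sq_nonneg (hsNorm T)), ← htsum,
    ENNReal.tsum_toReal_eq fun i => by simp]
  simp

theorem IsHilbertSchmidt.adjoint [CompleteSpace F] (hT : IsHilbertSchmidt T) :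
    IsHilbertSchmidt T.adjoint ∧ hsNorm T.adjoint ≤ hsNorm T :=
  isHilbertSchmidt_of_tsum_enorm_sq_le (hsNorm_nonneg T) <| by
    rw [tsum_enorm_sq_adjoint (onb E) (onb F), hT.tsum_enorm_sq]

theorem IsHilbertSchmidt.comp_left (hT : IsHilbertSchmidt T) (S : F →L[ℝ] E') :
    IsHilbertSchmidt (S ∘L T) ∧ hsNorm (S ∘L T) ≤ hsNorm T * ‖S‖ :=
  isHilbertSchmidt_of_tsum_enorm_sq_le (mul_nonneg (hsNorm_nonneg T) (norm_nonneg S)) <| by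
    rw [mul_pow, ENNReal.ofReal_mul (sq_nonneg _), ← hT.tsum_enorm_sq, ← ENNReal.tsum_mul_right,
      ENNReal.ofReal_pow (norm_nonneg S), ofReal_norm]
    refine ENNReal.tsum_le_tsum fun i => ?_
    rw [← mul_pow, mul_comm]
    gcongr
    exact S.le_opENorm _

theorem IsHilbertSchmidt.comp [CompleteSpace F] [CompleteSpace E'] (hT : IsHilbertSchmidt T)
    (S : E' →L[ℝ] E) : IsHilbertSchmidt (T ∘L S) ∧ hsNorm (T ∘L S) ≤ hsNorm T * ‖S‖ := by
  obtain ⟨hadj, hadj_le⟩ := hT.adjoint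
  obtain ⟨hcomp, hcomp_le⟩ := hadj.comp_left S.adjoint
  obtain ⟨hcomp', hcomp_le'⟩ := hcomp.adjoint
  rw [ContinuousLinearMap.adjoint_comp, ContinuousLinearMap.adjoint_adjoint,
    ContinuousLinearMap.adjoint_adjoint] at hcomp' hcomp_le'
  rw [LinearIsometryEquiv.norm_map] at hcomp_le
  refine ⟨hcomp', hcomp_le'.trans (hcomp_le.trans ?_)⟩
  gcongr

theorem IsHilbertSchmidt.memℓp (hT : IsHilbertSchmidt T) : Memℓp (fun i => T (onb E i)) 2 :=
  memℓp_gen (by simpa [IsHilbertSchmidt] using hT)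

/-- The values of a Hilbert–Schmidt operator on the fixed orthonormal basis. -/
noncomputable def IsHilbertSchmidt.toLp (hT : IsHilbertSchmidt T) :
    lp (fun _ : basisIndex E => F) 2 :=
  ⟨_, hT.memℓp⟩

theorem IsHilbertSchmidt.norm_toLp (hT : IsHilbertSchmidt T) : ‖hT.toLp‖ = hsNorm T := by
  refine (sq_eq_sq₀ (norm_nonneg _) (hsNorm_nonneg T)).mp ?_
  rw [hsNorm_sq]
  simpa [IsHilbertSchmidt.toLp] using lp.norm_rpow_eq_tsum (p := 2) (by norm_num) hT.toLp

theorem IsHilbertSchmidt.add (hS : IsHilbertSchmidt S) (hT : IsHilbertSchmidt T) :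
    IsHilbertSchmidt (S + T) ∧ hsNorm (S + T) ≤ hsNorm S + hsNorm T := by
  have hST : IsHilbertSchmidt (S + T) := by
    simpa [IsHilbertSchmidt] using (memℓp_gen_iff (by norm_num)).mp (hS.memℓp.add hT.memℓp)
  refine ⟨hST, ?_⟩
  rw [← hS.norm_toLp, ← hT.norm_toLp, ← hST.norm_toLp]
  exact norm_add_le hS.toLp hT.toLp

theorem IsHilbertSchmidt.norm_le [CompleteSpace F] (hT : IsHilbertSchmidt T) : ‖T‖ ≤ hsNorm T := by
  refine ContinuousLinearMap.opNorm_le_bound _ (hsNorm_nonneg T) fun v => ?_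
  obtain ⟨hadj, hadj_le⟩ := hT.adjoint
  refine (sq_le_sq₀ (norm_nonneg _) (by positivity [hsNorm_nonneg T])).mp ?_
  calc ‖T v‖ ^ 2 ≤ hsNorm T.adjoint ^ 2 * ‖v‖ ^ 2 := by
        refine hasSum_le (fun j => ?_) (hasSum_inner_sq (onb F) (T v))
          ((hadj.hasSum_norm_sq (onb F)).mul_right (‖v‖ ^ 2))
        rw [← ContinuousLinearMap.adjoint_inner_left, ← mul_pow, ← sq_abs]
        exact pow_le_pow_left₀ (abs_nonneg _) (abs_real_inner_le_norm _ _) 2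
    _ ≤ (hsNorm T * ‖v‖) ^ 2 := by
        rw [mul_pow]
        gcongr
        exact hsNorm_nonneg _

end HilbertSchmidt

section Perturbation

theorem norm_pow_sub_pow_le {A : Type*} [NormedRing A] (hone : ‖(1 : A)‖ ≤ 1) {P Q : A} {q ε : ℝ}
    (hP : ‖P‖ ≤ q) (hQ : ‖Q‖ ≤ q) (h : ‖Q - P‖ ≤ ε * q) (m : ℕ) :
    ‖Q ^ m - P ^ m‖ ≤ m * ε * q ^ m := by
  have hq : 0 ≤ q := (norm_nonneg P).trans hP
  have hpow (k : ℕ) : ‖P ^ k‖ ≤ q ^ k := by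
    induction k with
    | zero => simpa using hone
    | succ k ih =>
      rw [pow_succ, pow_succ]
      exact (norm_mul_le _ _).trans (mul_le_mul ih hP (norm_nonneg _) (by positivity))
  induction m with
  | zero => simp
  | succ m ih =>
    calc ‖Q ^ (m + 1) - P ^ (m + 1)‖ = ‖(Q ^ m - P ^ m) * Q + P ^ m * (Q - P)‖ := by
          congr 1
          noncomm_ring
      _ ≤ ‖Q ^ m - P ^ m‖ * ‖Q‖ + ‖P ^ m‖ * ‖Q - P‖ :=
          (norm_add_le _ _).trans (add_le_add (norm_mul_le _ _) (norm_mul_le _ _))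
      _ ≤ m * ε * q ^ m * q + q ^ m * (ε * q) := by
          gcongr
          · exact (norm_nonneg _).trans ih
          · exact hpow m
      _ = (m + 1 : ℕ) * ε * q ^ (m + 1) := by push_cast; ring

variable {E F ι ι' : Type*} [NormedAddCommGroup E] [InnerProductSpace ℝ E]
  [NormedAddCommGroup F] [InnerProductSpace ℝ F] {C C' : E →L[ℝ] E} {lam : ℝ}

namespace PosEigenbasis

theorem exists_func_eq_shiftPow_neg_mul (d : PosEigenbasis ι C) (hlam : 0 < lam) {f : ℝ → ℝ}
    {r K : ℝ} (hK : 0 ≤ K) (hf : ∀ i, |f (d.eigenvalue i)| * (d.eigenvalue i + lam) ^ r ≤ K) :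
    ∃ V : E →L[ℝ] E, ‖V‖ ≤ K ∧ d.func f = d.shiftPow lam (-r) * V ∧
      d.func f = V * d.shiftPow lam (-r) := by
  have hbound (i : ι) : |f (d.eigenvalue i) * (d.eigenvalue i + lam) ^ r| ≤ K := by
    have := d.eigenvalue_nonneg i
    rw [abs_mul, abs_of_nonneg (a := (_ : ℝ) ^ r) (by positivity)]
    exact hf i
  have hcancel (t : ℝ) (ht : 0 ≤ t) : (t + lam) ^ (-r) * (f t * (t + lam) ^ r) = f t := by
    rw [mul_left_comm, ← Real.rpow_add (by linarith), neg_add_cancel, Real.rpow_zero, mul_one]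
  refine ⟨d.func fun t => f t * (t + lam) ^ r, norm_func_le hK hbound,
    (func_mul_func (d.bdd_shiftPow hlam _) ⟨K, hbound⟩ hcancel).symm,
    (func_mul_func ⟨K, hbound⟩ (d.bdd_shiftPow hlam _) fun t ht => ?_).symm⟩
  rw [mul_comm, hcancel t ht]

theorem norm_shiftPow_neg_one_le (d : PosEigenbasis ι C) (hlam : 0 < lam) :
    ‖d.shiftPow lam (-1)‖ ≤ lam⁻¹ := by
  simpa only [Real.rpow_neg_one] using d.norm_shiftPow_le hlam (r := -1) (by norm_num)

theorem norm_shiftPow_neg_one_mul_le (d : PosEigenbasis ι C) (hlam : 0 < lam) {S : E →L[ℝ] E}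
    {τ : ℝ} (hτ : ‖d.shiftPow lam (-(1 / 2)) * S‖ ≤ τ) :
    ‖d.shiftPow lam (-1) * S‖ ≤ τ / √lam := by
  have hsplit : d.shiftPow lam (-1) = d.shiftPow lam (-(1 / 2)) * d.shiftPow lam (-(1 / 2)) := by
    rw [d.shiftPow_mul_shiftPow hlam]
    norm_num
  have hnorm := d.norm_shiftPow_le hlam (r := -(1 / 2)) (by norm_num)
  rw [Real.rpow_neg hlam.le, ← Real.sqrt_eq_rpow] at hnorm
  calc ‖d.shiftPow lam (-1) * S‖
      = ‖d.shiftPow lam (-(1 / 2)) * (d.shiftPow lam (-(1 / 2)) * S)‖ := by rw [hsplit, mul_assoc]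
    _ ≤ (√lam)⁻¹ * τ := norm_mul_le_of_le hnorm hτ
    _ = τ / √lam := inv_mul_eq_div _ _

variable (d : PosEigenbasis ι C) (d' : PosEigenbasis ι' C') (hlam : 0 < lam)
include hlam

theorem norm_shiftPow_neg_one_sub_le {ε : ℝ} (hε : ‖d.shiftPow lam (-1) * (C' - C)‖ ≤ ε) :
    ‖d'.shiftPow lam (-1) - d.shiftPow lam (-1)‖ ≤ ε * lam⁻¹ := by
  have hC := d.shiftPow_neg_mul_shiftPow hlam 1
  have hC' := d'.shiftPow_mul_shiftPow_neg hlam 1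
  rw [d.shiftPow_one hlam] at hC
  rw [d'.shiftPow_one hlam] at hC'
  set P := d.shiftPow lam (-1)
  set Q := d'.shiftPow lam (-1)
  calc ‖Q - P‖ = ‖-(P * (C' - C) * Q)‖ := by
        congr 1
        calc Q - P = (P * (C + lam • 1)) * Q - P * ((C' + lam • 1) * Q) := by
              rw [hC, hC', one_mul, mul_one]
          _ = -((P * (C' - C)) * Q) := by noncomm_ring
    _ ≤ ‖P * (C' - C)‖ * ‖Q‖ := (norm_neg _).trans_le (norm_mul_le _ _)
    _ ≤ ε * lam⁻¹ :=
        mul_le_mul hε (d'.norm_shiftPow_neg_one_le hlam) (norm_nonneg _)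
          ((norm_nonneg _).trans hε)

theorem norm_shiftPow_neg_sub_le {ε : ℝ} (hε : ‖d.shiftPow lam (-1) * (C' - C)‖ ≤ ε) (m : ℕ)
    {r : ℝ} (hr : 0 ≤ r) :
    ‖d'.shiftPow lam (-(m + r)) - d.shiftPow lam (-m) * d'.shiftPow lam (-r)‖
      ≤ m * ε * lam ^ (-(m + r)) := by
  have hfactor : d'.shiftPow lam (-(m + r)) - d.shiftPow lam (-m) * d'.shiftPow lam (-r)
      = (d'.shiftPow lam (-1) ^ m - d.shiftPow lam (-1) ^ m) * d'.shiftPow lam (-r) := by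
    rw [sub_mul, d'.shiftPow_pow hlam, d.shiftPow_pow hlam, d'.shiftPow_mul_shiftPow hlam,
      mul_neg_one, neg_add]
  calc _ ≤ m * ε * lam⁻¹ ^ m * lam ^ (-r) := by
        rw [hfactor]
        exact norm_mul_le_of_le (norm_pow_sub_pow_le ContinuousLinearMap.norm_id_le
          (d.norm_shiftPow_neg_one_le hlam) (d'.norm_shiftPow_neg_one_le hlam)
          (d.norm_shiftPow_neg_one_sub_le d' hlam hε) m)
          (d'.norm_shiftPow_le hlam (neg_nonpos.mpr hr))
    _ = m * ε * lam ^ (-(m + r)) := by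
        rw [mul_assoc, inv_pow, ← Real.rpow_natCast, ← Real.rpow_neg hlam.le,
          ← Real.rpow_add hlam, neg_add]

variable [CompleteSpace E]

theorem norm_mul_shiftPow {S : E →L[ℝ] E} (hS : ∀ v w, ⟪S v, w⟫ = ⟪v, S w⟫) (r : ℝ) :
    ‖S * d.shiftPow lam r‖ = ‖d.shiftPow lam r * S‖ := by
  have hadj : S * d.shiftPow lam r = (d.shiftPow lam r * S).adjoint := by
    rw [ContinuousLinearMap.eq_adjoint_iff]
    intro x y
    rw [mul_apply_eq_comp, mul_apply_eq_comp, hS]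
    exact inner_func_left (d.bdd_shiftPow hlam r) _ _
  rw [hadj, LinearIsometryEquiv.norm_map]

include d' in
theorem norm_add_smul_apply_le (hε : ‖d.shiftPow lam (-1) * (C' - C)‖ ≤ 1 / 2) (v : E) :
    ‖(C + lam • 1 : E →L[ℝ] E) v‖ ≤ 2 * ‖(C' + lam • 1 : E →L[ℝ] E) v‖ := by
  have hsymm (v w : E) : ⟪(C' - C) v, w⟫ = ⟪v, (C' - C) w⟫ := by
    rw [sub_apply, sub_apply, inner_sub_left, inner_sub_right, d.isSymmetric, d'.isSymmetric]
  have hdiff : (C' - C) v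
      = ((C' - C) * d.shiftPow lam (-1)) ((C + lam • 1 : E →L[ℝ] E) v) := by
    rw [← mul_apply_eq_comp, mul_assoc, ← d.shiftPow_one hlam,
      d.shiftPow_neg_mul_shiftPow hlam, mul_one]
  have hhalf : ‖(C' - C) v‖ ≤ 1 / 2 * ‖(C + lam • 1 : E →L[ℝ] E) v‖ := by
    rw [hdiff]
    refine ContinuousLinearMap.le_of_opNorm_le _ ?_ _
    rwa [d.norm_mul_shiftPow hlam hsymm]
  have htri := norm_sub_le ((C' + lam • 1 : E →L[ℝ] E) v) ((C' - C) v)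
  rw [← sub_apply, show C' + lam • 1 - (C' - C) = C + lam • 1 by abel] at htri
  linarith

theorem norm_shiftPow_mul_shiftPow_neg_le [Countable ι] [Countable ι']
    (hε : ‖d.shiftPow lam (-1) * (C' - C)‖ ≤ 1 / 2) {r : ℝ} (hr : r ∈ Set.Ico 0 1) :
    ‖d.shiftPow lam r * d'.shiftPow lam (-r)‖ ≤ 2 ^ r := by
  rcases hr.1.eq_or_lt with rfl | hr0
  · rw [neg_zero, d.shiftPow_zero, d'.shiftPow_zero, mul_one, Real.rpow_zero]
    exact ContinuousLinearMap.norm_id_le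
  · refine ContinuousLinearMap.opNorm_le_bound _ (by positivity) fun v => ?_
    refine (d.norm_shiftPow_apply_le d' hlam.le zero_le_two
      (d.norm_add_smul_apply_le d' hlam hε) ⟨hr0, hr.2⟩ _).trans_eq ?_
    rw [ContinuousLinearMap.coe_coe, ← mul_apply_eq_comp, d'.shiftPow_mul_shiftPow_neg hlam,
      one_apply_eq_self]

/-- Only the fractional part of the exponent is compared through the Heinz inequality: the integer
powers of the resolvents are compared directly. -/
theorem exists_shiftPow_neg_approx [Countable ι] [Countable ι'] {ε : ℝ}
    (hε : ‖d.shiftPow lam (-1) * (C' - C)‖ ≤ ε) (hε2 : ε ≤ 1 / 2) {ν : ℝ} (hν : 0 ≤ ν) :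
    ∃ Z : E →L[ℝ] E, ‖d'.shiftPow lam (-ν) - Z‖ ≤ ⌊ν⌋₊ * ε * lam ^ (-ν) ∧
      ‖d.shiftPow lam ν * Z‖ ≤ 2 ^ (ν - ⌊ν⌋₊) := by
  have hr : ν - ⌊ν⌋₊ ∈ Set.Ico 0 1 :=
    ⟨sub_nonneg.mpr (Nat.floor_le hν), by linarith [Nat.lt_floor_add_one ν]⟩
  refine ⟨d.shiftPow lam (-⌊ν⌋₊) * d'.shiftPow lam (-(ν - ⌊ν⌋₊)), ?_, ?_⟩
  · simpa only [add_sub_cancel] using d.norm_shiftPow_neg_sub_le d' hlam hε ⌊ν⌋₊ hr.1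
  · rw [← mul_assoc, d.shiftPow_mul_shiftPow hlam, ← sub_eq_add_neg]
    exact d.norm_shiftPow_mul_shiftPow_neg_le d' hlam (hε.trans hε2) hr

variable [CompleteSpace F]

theorem hsNorm_comp_func_residual_le [Countable ι] [Countable ι'] {ε : ℝ}
    (hε : ‖d.shiftPow lam (-1) * (C' - C)‖ ≤ ε) (hε2 : ε ≤ 1 / 2) {T T₀ : E →L[ℝ] F}
    (hT : IsHilbertSchmidt T) (hT₀ : IsHilbertSchmidt T₀) {ψ ρ : ℝ → ℝ}
    (hsource : T = T₀ ∘L d.func ψ) {ν R Ψ : ℝ} (hν : 0 ≤ ν) (hΨ : 0 ≤ Ψ) (hR : 0 ≤ R)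
    (hψ : ∀ i, |ψ (d.eigenvalue i)| * (d.eigenvalue i + lam) ^ (-ν) ≤ Ψ * lam ^ (-ν))
    (hρ : ∀ j, |ρ (d'.eigenvalue j)| * (d'.eigenvalue j + lam) ^ ν ≤ R * lam ^ ν) :
    IsHilbertSchmidt (T ∘L d'.func ρ) ∧ hsNorm (T ∘L d'.func ρ)
      ≤ hsNorm T * (⌊ν⌋₊ * ε * R) + hsNorm T₀ * (Ψ * 2 ^ (ν - ⌊ν⌋₊) * R) := by
  have hlamν : lam ^ (-ν) * lam ^ ν = 1 := by
    rw [← Real.rpow_add hlam, neg_add_cancel, Real.rpow_zero]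
  obtain ⟨Z, hZ, hZν⟩ := d.exists_shiftPow_neg_approx d' hlam hε hε2 hν
  obtain ⟨U, hU, -, hUψ⟩ := d.exists_func_eq_shiftPow_neg_mul hlam (by positivity) hψ
  obtain ⟨V, hV, hVρ, -⟩ := d'.exists_func_eq_shiftPow_neg_mul hlam (by positivity) hρ
  rw [neg_neg] at hUψ
  have hsplit : T ∘L d'.func ρ
      = T ∘L ((d'.shiftPow lam (-ν) - Z) * V) + T₀ ∘L (U * (d.shiftPow lam ν * Z) * V) := by
    have hZ : T ∘L (Z * V) = T₀ ∘L (U * (d.shiftPow lam ν * Z) * V) := by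
      rw [hsource, hUψ]
      rfl
    rw [← hZ, ← ContinuousLinearMap.comp_add, sub_mul, sub_add_cancel, hVρ]
  have happrox : ‖(d'.shiftPow lam (-ν) - Z) * V‖ ≤ ⌊ν⌋₊ * ε * R := by
    calc _ ≤ ⌊ν⌋₊ * ε * lam ^ (-ν) * (R * lam ^ ν) := norm_mul_le_of_le hZ hV
      _ = ⌊ν⌋₊ * ε * R * (lam ^ (-ν) * lam ^ ν) := by ring
      _ = ⌊ν⌋₊ * ε * R := by rw [hlamν, mul_one]
  have hmain : ‖U * (d.shiftPow lam ν * Z) * V‖ ≤ Ψ * 2 ^ (ν - ⌊ν⌋₊) * R := by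
    calc _ ≤ Ψ * lam ^ (-ν) * 2 ^ (ν - ⌊ν⌋₊) * (R * lam ^ ν) :=
          norm_mul_le_of_le (norm_mul_le_of_le hU hZν) hV
      _ = Ψ * 2 ^ (ν - ⌊ν⌋₊) * R * (lam ^ (-ν) * lam ^ ν) := by ring
      _ = Ψ * 2 ^ (ν - ⌊ν⌋₊) * R := by rw [hlamν, mul_one]
  obtain ⟨hS, hS_le⟩ := hT.comp ((d'.shiftPow lam (-ν) - Z) * V)
  obtain ⟨hS₀, hS₀_le⟩ := hT₀.comp (U * (d.shiftPow lam ν * Z) * V)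
  rw [hsplit]
  refine ⟨(hS.add hS₀).1, (hS.add hS₀).2.trans (add_le_add (hS_le.trans ?_) (hS₀_le.trans ?_))⟩
  · exact mul_le_mul_of_nonneg_left happrox (hsNorm_nonneg _)
  · exact mul_le_mul_of_nonneg_left hmain (hsNorm_nonneg _)

theorem hsNorm_comp_func_filter_le [Countable ι] [Countable ι']
    (hε : ‖d.shiftPow lam (-1) * (C' - C)‖ ≤ 1 / 2) {W : E →L[ℝ] F} {η Γ : ℝ}
    (hW : IsHilbertSchmidt (W ∘L d.shiftPow lam (-(1 / 2))))
    (hη : hsNorm (W ∘L d.shiftPow lam (-(1 / 2))) ≤ η) {f : ℝ → ℝ} (hΓ : 0 ≤ Γ)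
    (hf : ∀ j, |f (d'.eigenvalue j)| * √(d'.eigenvalue j + lam) ≤ Γ) :
    IsHilbertSchmidt (W ∘L d'.func f) ∧ hsNorm (W ∘L d'.func f) ≤ η * (√2 * Γ) := by
  simp only [Real.sqrt_eq_rpow] at hf ⊢
  obtain ⟨V, hV, hVf, -⟩ := d'.exists_func_eq_shiftPow_neg_mul hlam hΓ hf
  have hfac : W ∘L d'.func f = (W ∘L d.shiftPow lam (-(1 / 2))) ∘L
      (d.shiftPow lam (1 / 2) * d'.shiftPow lam (-(1 / 2)) * V) := by
    calc W ∘L d'.func f = W ∘L (d.shiftPow lam (-(1 / 2)) * d.shiftPow lam (1 / 2)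
          * (d'.shiftPow lam (-(1 / 2)) * V)) := by
          rw [d.shiftPow_neg_mul_shiftPow hlam, one_mul, hVf]
      _ = _ := rfl
  obtain ⟨hS, hS_le⟩ := hW.comp (d.shiftPow lam (1 / 2) * d'.shiftPow lam (-(1 / 2)) * V)
  rw [hfac]
  refine ⟨hS, hS_le.trans (mul_le_mul hη ?_ (norm_nonneg _) ((hsNorm_nonneg _).trans hη))⟩
  exact norm_mul_le_of_le
    (d.norm_shiftPow_mul_shiftPow_neg_le d' hlam hε (by norm_num)) hV

end PosEigenbasis

end Perturbation

section Concentration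

theorem cosh_norm_le_of_norm_sq_eq {K : Type*} [SeminormedAddCommGroup K] {x : K}
    {w₁ w₂ p q : ℝ} (h₁ : 0 ≤ w₁) (h₂ : 0 ≤ w₂) (hw : w₁ + w₂ = 1)
    (hx : ‖x‖ ^ 2 = w₁ * p ^ 2 + w₂ * q ^ 2) :
    Real.cosh ‖x‖ ≤ w₁ * Real.cosh p + w₂ * Real.cosh q := by
  refine hasSum_le (fun k => ?_) (Real.hasSum_cosh ‖x‖)
    (((Real.hasSum_cosh p).mul_left w₁).add ((Real.hasSum_cosh q).mul_left w₂))
  have hconvex := (convexOn_pow k).2 (sq_nonneg p) (sq_nonneg q) h₁ h₂ hw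
  simp only [smul_eq_mul] at hconvex
  rw [pow_mul, hx, pow_mul, pow_mul, ← mul_div_assoc, ← mul_div_assoc, ← add_div]
  gcongr

variable {K : Type*} [NormedAddCommGroup K] [InnerProductSpace ℝ K]

/-- If `⟪x, y⟫ = κ ‖x‖ ‖y‖`, then `‖x + y‖²` is the average of `(‖x‖ + ‖y‖)²` and
`(‖x‖ - ‖y‖)²` with weights `(1 ± κ) / 2`, and `t ↦ cosh √t` is convex. -/
theorem cosh_norm_add_le (x y : K) :
    Real.cosh ‖x + y‖ ≤ Real.cosh ‖x‖ + Real.sinh ‖x‖ / ‖x‖ * ⟪x, y⟫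
      + Real.cosh ‖x‖ * (Real.exp ‖y‖ - 1 - ‖y‖) := by
  obtain ⟨κ, hκ_ge, hκ_le, hκ⟩ : ∃ κ : ℝ, -1 ≤ κ ∧ κ ≤ 1 ∧ ⟪x, y⟫ = κ * (‖x‖ * ‖y‖) := by
    have hcos := abs_le.mp (abs_real_inner_div_norm_mul_norm_le_one x y)
    refine ⟨_, hcos.1, hcos.2, (div_mul_cancel_of_imp fun h0 => ?_).symm⟩
    rcases mul_eq_zero.mp h0 with hx | hy
    · simp [norm_eq_zero.mp hx]
    · simp [norm_eq_zero.mp hy]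
  have haverage := cosh_norm_le_of_norm_sq_eq (x := x + y) (w₁ := (1 + κ) / 2)
    (w₂ := (1 - κ) / 2) (p := ‖x‖ + ‖y‖) (q := ‖x‖ - ‖y‖) (by linarith) (by linarith) (by ring)
    (by rw [norm_add_sq_real, hκ]; ring)
  have hinner : Real.sinh ‖x‖ / ‖x‖ * ⟪x, y⟫ = κ * (Real.sinh ‖x‖ * ‖y‖) := by
    rcases eq_or_ne ‖x‖ 0 with hx | hx
    · simp [hx]
    · rw [hκ]
      field_simp
  have hsinh_y : 0 ≤ Real.sinh ‖y‖ - ‖y‖ :=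
    sub_nonneg.mpr (Real.self_le_sinh_iff.mpr (norm_nonneg y))
  have hsinh_x : 0 ≤ Real.sinh ‖x‖ := Real.sinh_nonneg_iff.mpr (norm_nonneg x)
  have hremainder : κ * (Real.sinh ‖x‖ * (Real.sinh ‖y‖ - ‖y‖))
      ≤ Real.cosh ‖x‖ * (Real.sinh ‖y‖ - ‖y‖) := by
    have h := mul_le_mul_of_nonneg_right (Real.sinh_lt_cosh ‖x‖).le hsinh_y
    nlinarith [mul_nonneg hsinh_x hsinh_y]
  rw [Real.cosh_add, Real.cosh_sub] at haverage
  rw [hinner, ← Real.cosh_add_sinh ‖y‖]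
  linarith

theorem meas_mul_sqrt_lt_norm_le {Ω : Type*} [MeasurableSpace Ω] {μ : Measure Ω}
    {F : Type*} [NormedAddCommGroup F] {f : Ω → F} (hf : StronglyMeasurable f) {w a : ℝ}
    (hw : 0 ≤ w) (ha : 0 < a)
    (h : ∫⁻ ω, ENNReal.ofReal (‖f ω‖ ^ 2) ∂μ ≤ ENNReal.ofReal w) :
    μ {ω | a * √w < ‖f ω‖} ≤ ENNReal.ofReal (1 / a ^ 2) := by
  have hmeas : Measurable fun ω => ENNReal.ofReal (‖f ω‖ ^ 2) :=
    (hf.norm.pow 2).measurable.ennreal_ofReal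
  rcases hw.eq_or_lt with rfl | hw
  · rw [ENNReal.ofReal_zero, nonpos_iff_eq_zero, lintegral_eq_zero_iff hmeas] at h
    refine (measure_mono_null (fun ω hω => ?_) (ae_iff.mp h)).trans_le zero_le
    simpa using hω
  · calc μ {ω | a * √w < ‖f ω‖}
        ≤ μ {ω | ENNReal.ofReal (a ^ 2 * w) ≤ ENNReal.ofReal (‖f ω‖ ^ 2)} := by
          refine measure_mono fun ω (hω : a * √w < ‖f ω‖) => ENNReal.ofReal_le_ofReal ?_
          rw [← Real.sq_sqrt hw.le, ← mul_pow]
          exact pow_le_pow_left₀ (by positivity) hω.le 2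
      _ ≤ (∫⁻ ω, ENNReal.ofReal (‖f ω‖ ^ 2) ∂μ) / ENNReal.ofReal (a ^ 2 * w) :=
          meas_ge_le_lintegral_div hmeas.aemeasurable
            (ENNReal.ofReal_pos.mpr (by positivity)).ne' ENNReal.ofReal_ne_top
      _ ≤ ENNReal.ofReal w / ENNReal.ofReal (a ^ 2 * w) := by gcongr
      _ = ENNReal.ofReal (1 / a ^ 2) := by
          rw [← ENNReal.ofReal_div_of_pos (by positivity), div_mul_cancel_right₀ hw.ne', one_div]

variable {Ω : Type*} [MeasurableSpace Ω] {μ : Measure Ω}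

theorem stronglyMeasurable_sum_comp_eval {F : Type*} [NormedAddCommGroup F] {ξ : Ω → F}
    (hξ : StronglyMeasurable ξ) (n : ℕ) :
    StronglyMeasurable fun z : Fin n → Ω => ∑ i, ξ (z i) :=
  Finset.stronglyMeasurable_fun_sum _ fun i _ => hξ.comp_measurable (measurable_pi_apply i)

theorem lintegral_pi_sum_le [SigmaFinite μ] {F : Type*} [NormedAddCommGroup F] {ξ : Ω → F}
    (hξ : StronglyMeasurable ξ) {V : ℕ → F → ENNReal} (hV : Continuous (V 0))
    (h : ∀ k x, ∫⁻ ω, V k (x + ξ ω) ∂μ ≤ V (k + 1) x) (n : ℕ) (x : F) :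
    ∫⁻ z, V 0 (x + ∑ i, ξ (z i)) ∂(Measure.pi fun _ : Fin n => μ) ≤ V n x := by
  induction n generalizing x with
  | zero => simp
  | succ n ih =>
    have hmeas (m : ℕ) : Measurable fun z : Fin m → Ω => V 0 (x + ∑ i, ξ (z i)) :=
      (hV.comp_stronglyMeasurable
        (stronglyMeasurable_const.add (stronglyMeasurable_sum_comp_eval hξ m))).measurable
    have hsplit := (measurePreserving_piFinSuccAbove (fun _ : Fin (n + 1) => μ) 0).symm
    rw [← hsplit.lintegral_comp (hmeas _), lintegral_prod]
    · refine le_trans (lintegral_mono fun ω => ?_) (h n x)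
      refine le_of_eq_of_le (lintegral_congr fun z => ?_) (ih (x + ξ ω))
      simp [Fin.sum_univ_succ, add_assoc]
    · exact ((hmeas _).comp (MeasurableEquiv.measurable _)).aemeasurable

/-- A random vector with mean zero that is bounded by `L` almost surely and has variance at most
`v`. -/
structure IsCenteredBounded (μ : Measure Ω) (ξ : Ω → K) (L v : ℝ) : Prop where
  stronglyMeasurable : StronglyMeasurable ξ
  norm_le : ∀ᵐ ω ∂μ, ‖ξ ω‖ ≤ L
  integral_eq_zero : ∫ ω, ξ ω ∂μ = 0
  integral_norm_sq_le : ∫ ω, ‖ξ ω‖ ^ 2 ∂μ ≤ v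

namespace IsCenteredBounded

variable {ξ : Ω → K} {L v : ℝ}

theorem variance_nonneg (hξ : IsCenteredBounded μ ξ L v) : 0 ≤ v :=
  (integral_nonneg fun _ => sq_nonneg _).trans hξ.integral_norm_sq_le

theorem const_smul (hξ : IsCenteredBounded μ ξ L v) (c : ℝ) :
    IsCenteredBounded μ (fun ω => c • ξ ω) (|c| * L) (c ^ 2 * v) where
  stronglyMeasurable := hξ.stronglyMeasurable.const_smul c
  norm_le := hξ.norm_le.mono fun ω h => by
    rw [norm_smul, Real.norm_eq_abs]
    gcongr
  integral_eq_zero := by rw [integral_smul, hξ.integral_eq_zero, smul_zero]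
  integral_norm_sq_le := by
    simp only [norm_smul, mul_pow, integral_const_mul, Real.norm_eq_abs, sq_abs]
    exact mul_le_mul_of_nonneg_left hξ.integral_norm_sq_le (sq_nonneg c)

variable [IsProbabilityMeasure μ]

theorem bound_nonneg (hξ : IsCenteredBounded μ ξ L v) : 0 ≤ L :=
  let ⟨_, h⟩ := hξ.norm_le.exists
  (norm_nonneg _).trans h

theorem integrable (hξ : IsCenteredBounded μ ξ L v) : Integrable ξ μ :=
  .of_bound hξ.stronglyMeasurable.aestronglyMeasurable L hξ.norm_le

theorem integrable_norm_sq (hξ : IsCenteredBounded μ ξ L v) :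
    Integrable (fun ω => ‖ξ ω‖ ^ 2) μ := by
  refine .of_bound (hξ.stronglyMeasurable.norm.pow 2).aestronglyMeasurable (L ^ 2) ?_
  filter_upwards [hξ.norm_le] with ω h
  rw [norm_pow, norm_norm]
  gcongr

variable [CompleteSpace K]

theorem integral_inner_eq_zero (hξ : IsCenteredBounded μ ξ L v) (x : K) :
    ∫ ω, ⟪x, ξ ω⟫ ∂μ = 0 := by
  rw [integral_inner hξ.integrable, hξ.integral_eq_zero, inner_zero_right]

theorem lintegral_norm_sum_sq_le (hξ : IsCenteredBounded μ ξ L v) (n : ℕ) :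
    ∫⁻ z, ENNReal.ofReal (‖∑ i, ξ (z i)‖ ^ 2) ∂(Measure.pi fun _ : Fin n => μ)
      ≤ ENNReal.ofReal (n * v) := by
  have hv := hξ.variance_nonneg
  have hiter := lintegral_pi_sum_le (μ := μ) hξ.stronglyMeasurable
    (V := fun k x => ENNReal.ofReal (‖x‖ ^ 2 + k * v))
    (ENNReal.continuous_ofReal.comp (by fun_prop)) (fun k x => ?_) n 0
  · simpa using hiter
  · have hexpand (ω : Ω) :
        ‖x + ξ ω‖ ^ 2 + k * v = ‖x‖ ^ 2 + k * v + 2 * ⟪x, ξ ω⟫ + ‖ξ ω‖ ^ 2 := by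
      rw [norm_add_sq_real]
      ring
    have hlin : Integrable (fun ω => 2 * ⟪x, ξ ω⟫) μ := (hξ.integrable.const_inner x).const_mul 2
    have haffine : Integrable (fun ω => ‖x‖ ^ 2 + k * v + 2 * ⟪x, ξ ω⟫) μ :=
      (integrable_const _).add hlin
    rw [← ofReal_integral_eq_lintegral_ofReal
      (by simp only [hexpand]; exact haffine.add hξ.integrable_norm_sq)
      (ae_of_all _ fun ω => by positivity)]
    refine ENNReal.ofReal_le_ofReal ?_
    simp only [hexpand]
    rw [integral_add haffine hξ.integrable_norm_sq,
      integral_add (integrable_const _) hlin, integral_const_mul, hξ.integral_inner_eq_zero]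
    simp only [integral_const, probReal_univ, one_smul, mul_zero, add_zero]
    push_cast
    linarith [hξ.integral_norm_sq_le]

theorem meas_norm_sum_gt_le_chebyshev (hξ : IsCenteredBounded μ ξ L v) (n : ℕ) {a : ℝ}
    (ha : 0 < a) :
    (Measure.pi fun _ : Fin n => μ) {z | a * √(n * v) < ‖∑ i, ξ (z i)‖}
      ≤ ENNReal.ofReal (1 / a ^ 2) :=
  meas_mul_sqrt_lt_norm_le (stronglyMeasurable_sum_comp_eval hξ.stronglyMeasurable n)
    (mul_nonneg n.cast_nonneg hξ.variance_nonneg) ha (hξ.lintegral_norm_sum_sq_le n)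

theorem lintegral_cosh_norm_add_le (hξ : IsCenteredBounded μ ξ 1 v) (x : K) :
    ∫⁻ ω, ENNReal.ofReal (Real.cosh ‖x + ξ ω‖) ∂μ
      ≤ ENNReal.ofReal ((1 + v) * Real.cosh ‖x‖) := by
  set c := Real.sinh ‖x‖ / ‖x‖
  have hlin : Integrable (fun ω => c * ⟪x, ξ ω⟫) μ := (hξ.integrable.const_inner x).const_mul c
  have haffine : Integrable (fun ω => Real.cosh ‖x‖ + c * ⟪x, ξ ω⟫) μ :=
    (integrable_const _).add hlin
  have hsq := hξ.integrable_norm_sq.const_mul (Real.cosh ‖x‖)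
  have hle : ∀ᵐ ω ∂μ, Real.cosh ‖x + ξ ω‖
      ≤ Real.cosh ‖x‖ + c * ⟪x, ξ ω⟫ + Real.cosh ‖x‖ * ‖ξ ω‖ ^ 2 := by
    filter_upwards [hξ.norm_le] with ω hω
    refine (cosh_norm_add_le x (ξ ω)).trans (add_le_add_right ?_ _)
    gcongr
    exact (le_abs_self _).trans (Real.abs_exp_sub_one_sub_id_le (by rwa [abs_norm]))
  calc ∫⁻ ω, ENNReal.ofReal (Real.cosh ‖x + ξ ω‖) ∂μ
      ≤ ∫⁻ ω, ENNReal.ofReal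
          (Real.cosh ‖x‖ + c * ⟪x, ξ ω⟫ + Real.cosh ‖x‖ * ‖ξ ω‖ ^ 2) ∂μ :=
        lintegral_mono_ae (hle.mono fun ω h => ENNReal.ofReal_le_ofReal h)
    _ = ENNReal.ofReal
          (∫ ω, Real.cosh ‖x‖ + c * ⟪x, ξ ω⟫ + Real.cosh ‖x‖ * ‖ξ ω‖ ^ 2 ∂μ) :=
        (ofReal_integral_eq_lintegral_ofReal (haffine.add hsq)
          (hle.mono fun ω h => (Real.cosh_pos _).le.trans h)).symm
    _ ≤ ENNReal.ofReal ((1 + v) * Real.cosh ‖x‖) := by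
        refine ENNReal.ofReal_le_ofReal ?_
        rw [integral_add haffine hsq, integral_add (integrable_const _) hlin, integral_const_mul,
          hξ.integral_inner_eq_zero, integral_const_mul]
        simp only [integral_const, probReal_univ, one_smul, mul_zero, add_zero]
        nlinarith [mul_le_mul_of_nonneg_left hξ.integral_norm_sq_le (Real.cosh_pos ‖x‖).le]

theorem lintegral_cosh_norm_sum_le (hξ : IsCenteredBounded μ ξ 1 v) (n : ℕ) :
    ∫⁻ z, ENNReal.ofReal (Real.cosh ‖∑ i, ξ (z i)‖) ∂(Measure.pi fun _ : Fin n => μ)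
      ≤ ENNReal.ofReal (Real.exp (n * v)) := by
  have hv : 0 ≤ 1 + v := add_nonneg zero_le_one hξ.variance_nonneg
  have hiter := lintegral_pi_sum_le (μ := μ) hξ.stronglyMeasurable
    (V := fun k x => ENNReal.ofReal ((1 + v) ^ k * Real.cosh ‖x‖))
    (ENNReal.continuous_ofReal.comp (by fun_prop)) (fun k x => ?_) n 0
  · refine le_trans (by simpa using hiter) (ENNReal.ofReal_le_ofReal ?_)
    rw [Real.exp_nat_mul]
    exact pow_le_pow_left₀ hv (by linarith [Real.add_one_le_exp v]) n
  · simp_rw [ENNReal.ofReal_mul (pow_nonneg hv k)]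
    rw [lintegral_const_mul' _ _ ENNReal.ofReal_ne_top, pow_succ, mul_assoc,
      ENNReal.ofReal_mul (pow_nonneg hv k)]
    gcongr
    exact hξ.lintegral_cosh_norm_add_le x

theorem meas_le_norm_sum_le_exp (hξ : IsCenteredBounded μ ξ 1 v) {n : ℕ} (hn : n * v ≤ 1)
    (t : ℝ) :
    (Measure.pi fun _ : Fin n => μ) {z | t ≤ ‖∑ i, ξ (z i)‖}
      ≤ ENNReal.ofReal (2 * Real.exp (1 - t)) := by
  have hmeas : Measurable fun z : Fin n → Ω => ENNReal.ofReal (Real.cosh ‖∑ i, ξ (z i)‖) :=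
    (Real.continuous_cosh.comp_stronglyMeasurable
      (stronglyMeasurable_sum_comp_eval hξ.stronglyMeasurable n).norm).measurable.ennreal_ofReal
  calc (Measure.pi fun _ : Fin n => μ) {z | t ≤ ‖∑ i, ξ (z i)‖}
      ≤ (Measure.pi fun _ : Fin n => μ) {z | ENNReal.ofReal (Real.exp t / 2)
        ≤ ENNReal.ofReal (Real.cosh ‖∑ i, ξ (z i)‖)} := by
        refine measure_mono fun z (hz : t ≤ _) => ENNReal.ofReal_le_ofReal ?_
        rw [Real.cosh_eq]
        linarith [Real.exp_le_exp.mpr hz, Real.exp_pos (-‖∑ i, ξ (z i)‖)]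
    _ ≤ (∫⁻ z, ENNReal.ofReal (Real.cosh ‖∑ i, ξ (z i)‖) ∂(Measure.pi fun _ : Fin n => μ))
        / ENNReal.ofReal (Real.exp t / 2) :=
        meas_ge_le_lintegral_div hmeas.aemeasurable
          (ENNReal.ofReal_pos.mpr (by positivity)).ne' ENNReal.ofReal_ne_top
    _ ≤ ENNReal.ofReal (Real.exp 1) / ENNReal.ofReal (Real.exp t / 2) := by
        gcongr
        exact (hξ.lintegral_cosh_norm_sum_le n).trans
          (ENNReal.ofReal_le_ofReal (Real.exp_le_exp.mpr hn))
    _ = ENNReal.ofReal (2 * Real.exp (1 - t)) := by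
        rw [← ENNReal.ofReal_div_of_pos (by positivity), Real.exp_sub]
        congr 1
        field_simp

/-- Pinelis' inequality. -/
theorem meas_norm_sum_gt_le_exp (hξ : IsCenteredBounded μ ξ L v) (n : ℕ) (l : ℝ) :
    (Measure.pi fun _ : Fin n => μ) {z | 2 * (L + √(n * v)) * l < ‖∑ i, ξ (z i)‖}
      ≤ ENNReal.ofReal (2 * Real.exp (1 - 2 * l)) := by
  have hL := hξ.bound_nonneg
  set S := L + √(n * v)
  have hLS : L ≤ S := le_add_of_nonneg_right (Real.sqrt_nonneg _)
  have hvS : √(n * v) ≤ S := le_add_of_nonneg_left hL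
  rcases (hL.trans hLS).eq_or_lt with hS | hS
  · have hae : ∀ᵐ z ∂(Measure.pi fun _ : Fin n => μ), ∀ i, ‖ξ (z i)‖ ≤ L :=
      ae_all_iff.mpr fun i =>
        (Measure.quasiMeasurePreserving_eval (fun _ : Fin n => μ) i).ae hξ.norm_le
    refine (measure_mono_null (fun z hz hz0 => ?_) (ae_iff.mp hae)).trans_le zero_le
    have hzero (i : Fin n) : ξ (z i) = 0 := norm_le_zero_iff.mp ((hz0 i).trans (hLS.trans hS.ge))
    simp [← hS, hzero] at hz
  · have hscaled : IsCenteredBounded μ (fun ω => S⁻¹ • ξ ω) 1 (S⁻¹ ^ 2 * v) :=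
      { hξ.const_smul S⁻¹ with
        norm_le := (hξ.const_smul S⁻¹).norm_le.mono fun ω h => h.trans <| by
          rwa [abs_of_pos (inv_pos.mpr hS), inv_mul_le_one₀ hS] }
    have hvar : n * (S⁻¹ ^ 2 * v) ≤ 1 := by
      rw [inv_pow, mul_left_comm, inv_mul_le_one₀ (by positivity)]
      exact (Real.sqrt_le_left hS.le).mp hvS
    refine (measure_mono fun z hz => ?_).trans (hscaled.meas_le_norm_sum_le_exp hvar (2 * l))
    have hz : 2 * S * l < ‖∑ i, ξ (z i)‖ := hz
    change 2 * l ≤ ‖∑ i, S⁻¹ • ξ (z i)‖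
    rw [← Finset.smul_sum, norm_smul, Real.norm_of_nonneg (inv_pos.mpr hS).le,
      le_inv_mul_iff₀ hS]
    linarith

end IsCenteredBounded

theorem inv_sq_log_add_inv_sq_log_le {δ : ℝ} (hδ : δ ∈ Set.Ioo (0 : ℝ) 1)
    (hl : Real.log (2 / δ) ≤ 1 + Real.log 2) :
    1 / (2 * Real.log (2 / δ)) ^ 2 + 1 / (√5 * Real.log (2 / δ)) ^ 2 ≤ δ := by
  have hδ0 := hδ.1
  have hlog2 := Real.log_two_gt_d9
  set y := Real.log δ⁻¹ with hy
  have hlog : Real.log (2 / δ) = Real.log 2 + y := by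
    rw [div_eq_mul_inv, Real.log_mul two_ne_zero (inv_ne_zero hδ0.ne')]
  have hy0 : 0 ≤ y := Real.log_nonneg ((one_le_inv₀ hδ0).mpr hδ.2.le)
  have hexp : δ⁻¹ ≤ 1 + y + y ^ 2 := by
    have h := Real.abs_exp_sub_one_sub_id_le (x := y) (by rw [abs_of_nonneg hy0]; linarith)
    rw [hy, Real.exp_log (inv_pos.mpr hδ0), ← hy] at h
    linarith [le_abs_self (δ⁻¹ - 1 - y)]
  rw [hlog, mul_pow, mul_pow, Real.sq_sqrt (by norm_num)]
  calc 1 / (2 ^ 2 * (Real.log 2 + y) ^ 2) + 1 / (5 * (Real.log 2 + y) ^ 2)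
      = δ * (9 / 20 * δ⁻¹) / (Real.log 2 + y) ^ 2 := by
        field_simp
        norm_num
    _ ≤ δ * (Real.log 2 + y) ^ 2 / (Real.log 2 + y) ^ 2 := by
        gcongr
        nlinarith
    _ = δ := by field_simp

theorem four_mul_exp_one_sub_two_mul_log_le {δ : ℝ} (hδ : 0 < δ)
    (hl : 1 + Real.log 2 ≤ Real.log (2 / δ)) :
    2 * Real.exp (1 - 2 * Real.log (2 / δ)) + 2 * Real.exp (1 - 2 * Real.log (2 / δ)) ≤ δ := by
  have hle : Real.exp (1 - 2 * Real.log (2 / δ)) ≤ Real.exp (-Real.log 2 - Real.log (2 / δ)) :=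
    Real.exp_le_exp.mpr (by linarith)
  rw [Real.exp_sub (-_), Real.exp_neg, Real.exp_log two_pos, Real.exp_log (by positivity)] at hle
  calc _ = 4 * Real.exp (1 - 2 * Real.log (2 / δ)) := by ring
    _ ≤ 4 * (2⁻¹ / (2 / δ)) := by gcongr
    _ = δ := by field_simp; norm_num

/-- Chebyshev's inequality when `δ` is not small, otherwise Pinelis' inequality. -/
theorem meas_norm_sum_gt_union_le [IsProbabilityMeasure μ] [CompleteSpace K] {K' : Type*}
    [NormedAddCommGroup K'] [InnerProductSpace ℝ K'] [CompleteSpace K'] {ξ : Ω → K} {ξ' : Ω → K'}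
    {L v L' v' : ℝ} (hξ : IsCenteredBounded μ ξ L v) (hξ' : IsCenteredBounded μ ξ' L' v')
    (n : ℕ) {δ : ℝ} (hδ : δ ∈ Set.Ioo (0 : ℝ) 1) :
    (Measure.pi fun _ : Fin n => μ)
      ({z | 2 * (L + √(n * v)) * Real.log (2 / δ) < ‖∑ i, ξ (z i)‖} ∪
        {z | √5 * (L' + √(n * v')) * Real.log (2 / δ) < ‖∑ i, ξ' (z i)‖}) ≤ ENNReal.ofReal δ := by
  have hl : 0 < Real.log (2 / δ) :=
    Real.log_pos ((one_lt_div hδ.1).mpr (by linarith [hδ.2]))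
  have hL := hξ.bound_nonneg
  have hL' := hξ'.bound_nonneg
  have hsqrt5 : 2 ≤ √5 := Real.le_sqrt_of_sq_le (by norm_num)
  refine (measure_union_le _ _).trans ?_
  rcases le_total (Real.log (2 / δ)) (1 + Real.log 2) with h | h
  · refine (add_le_add
      ((measure_mono ?_).trans
        (hξ.meas_norm_sum_gt_le_chebyshev n (a := 2 * Real.log (2 / δ)) (by positivity)))
      ((measure_mono ?_).trans
        (hξ'.meas_norm_sum_gt_le_chebyshev n (a := √5 * Real.log (2 / δ))
          (by positivity)))).trans ?_
    · refine fun z (hz : _ < _) => Set.mem_ofPred.mpr (lt_of_le_of_lt ?_ hz)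
      nlinarith [mul_nonneg hL hl.le]
    · refine fun z (hz : _ < _) => Set.mem_ofPred.mpr (lt_of_le_of_lt ?_ hz)
      nlinarith [mul_nonneg (mul_nonneg hL' hl.le) (Real.sqrt_nonneg 5)]
    · rw [← ENNReal.ofReal_add (by positivity) (by positivity)]
      exact ENNReal.ofReal_le_ofReal (inv_sq_log_add_inv_sq_log_le hδ h)
  · refine (add_le_add (hξ.meas_norm_sum_gt_le_exp n _)
      ((measure_mono ?_).trans (hξ'.meas_norm_sum_gt_le_exp n (Real.log (2 / δ))))).trans ?_
    · refine fun z (hz : _ < _) => Set.mem_ofPred.mpr (lt_of_le_of_lt ?_ hz)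
      gcongr
    · rw [← ENNReal.ofReal_add (by positivity) (by positivity)]
      exact ENNReal.ofReal_le_ofReal (four_mul_exp_one_sub_two_mul_log_le hδ.1 h)

end Concentration

section Tensor

variable {H F K ι : Type*} [NormedAddCommGroup H] [InnerProductSpace ℝ H]
  [NormedAddCommGroup F] [InnerProductSpace ℝ F] [NormedAddCommGroup K] [InnerProductSpace ℝ K]

/-- A continuous bilinear map whose values `A h y` have the inner products of elementary tensors
`h ⊗ y`. A Hilbert–Schmidt operator `T : H → F` then corresponds to the vector `∑ⱼ A uⱼ (T uⱼ)`, for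
any orthonormal basis `u` of `H`. -/
def IsTensor (A : H →L[ℝ] F →L[ℝ] K) : Prop :=
  ∀ h h' y y', ⟪A h y, A h' y'⟫ = ⟪h, h'⟫ * ⟪y, y'⟫

namespace IsTensor

variable {A : H →L[ℝ] F →L[ℝ] K}

theorem norm_apply (hA : IsTensor A) (h : H) (y : F) : ‖A h y‖ = ‖h‖ * ‖y‖ := by
  refine (sq_eq_sq₀ (norm_nonneg _) (by positivity)).mp ?_
  simp only [mul_pow, ← real_inner_self_eq_norm_sq, hA h h y y]

theorem hasSum_norm_sq (hA : IsTensor A) (u : HilbertBasis ι ℝ H) {w : ι → F} {k : K}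
    (hk : HasSum (fun j => A (u j) (w j)) k) : HasSum (fun j => ‖w j‖ ^ 2) (‖k‖ ^ 2) := by
  classical
  have hcoeff (j : ι) : ⟪k, A (u j) (w j)⟫ = ‖w j‖ ^ 2 := by
    rw [real_inner_comm]
    refine ((innerSL ℝ (A (u j) (w j))).hasSum hk).unique ?_
    convert! hasSum_ite_eq j (‖w j‖ ^ 2) using 2 with i
    rw [innerSL_apply_apply, hA, orthonormal_iff_ite.mp u.orthonormal]
    rcases eq_or_ne i j with rfl | hij
    · simp
    · simp [hij, hij.symm]
  simpa only [innerSL_apply_apply, hcoeff, real_inner_self_eq_norm_sq]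
    using (innerSL ℝ k).hasSum hk

theorem summable [CompleteSpace K] (hA : IsTensor A) (u : HilbertBasis ι ℝ H) {w : ι → F}
    (hw : Summable fun j => ‖w j‖ ^ 2) : Summable fun j => A (u j) (w j) := by
  have horth : OrthogonalFamily ℝ (fun _ : ι => F) fun j =>
      ({ toLinearMap := (A (u j)).toLinearMap
         norm_map' := fun y => by simp [hA.norm_apply, u.orthonormal.1] } : F →ₗᵢ[ℝ] K) :=
    fun i j hij y y' => (hA _ _ _ _).trans (by rw [u.orthonormal.2 hij, zero_mul])
  exact (horth.summable_iff_norm_sq_summable w).mpr hw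

theorem hsNorm_eq_norm [CompleteSpace H] [CompleteSpace F] (hA : IsTensor A)
    (u : HilbertBasis ι ℝ H) {T : H →L[ℝ] F} {k : K}
    (hk : HasSum (fun j => A (u j) (T (u j))) k) : IsHilbertSchmidt T ∧ hsNorm T = ‖k‖ := by
  have hsum := hA.hasSum_norm_sq u hk
  have hT : IsHilbertSchmidt T := by
    refine summable_norm_sq_of_tsum_enorm_sq ?_
    rw [tsum_enorm_sq_basis (onb H) u]
    simp_rw [← ofReal_norm, ← ENNReal.ofReal_pow (norm_nonneg _)]
    rw [← ENNReal.ofReal_tsum_of_nonneg (fun _ => sq_nonneg _) hsum.summable]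
    exact ENNReal.ofReal_ne_top
  exact ⟨hT, (sq_eq_sq₀ (hsNorm_nonneg T) (norm_nonneg k)).mp
    ((hT.hasSum_norm_sq u).unique hsum)⟩

theorem opNorm_le_of_inner (hA : IsTensor A) {T : H →L[ℝ] F} {k : K}
    (hk : ∀ h y, ⟪k, A h y⟫ = ⟪T h, y⟫) : ‖T‖ ≤ ‖k‖ := by
  refine T.opNorm_le_bound (norm_nonneg k) fun h => ?_
  rcases (norm_nonneg (T h)).eq_or_lt' with h0 | h0
  · rw [h0]
    positivity
  refine le_of_mul_le_mul_right ?_ h0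
  rw [← real_inner_self_eq_norm_mul_norm, ← hk, mul_assoc, ← hA.norm_apply]
  exact real_inner_le_norm _ _

end IsTensor

variable (H F) in
/-- The elementary tensors `h ⊗ y` in the Hilbert tensor product of `H` and `F`. -/
noncomputable def hilbertTensor : H →L[ℝ] F →L[ℝ] UniformSpace.Completion (TensorProduct ℝ H F) :=
  (ContinuousLinearMap.compL ℝ F _ _ UniformSpace.Completion.toComplL) ∘L
    TensorProduct.mkL ℝ H F

variable (H F) in
theorem isTensor_hilbertTensor : IsTensor (hilbertTensor H F) := fun h h' y y' => by
  simp [hilbertTensor, UniformSpace.Completion.inner_coe, TensorProduct.inner_tmul]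

end Tensor

section Feature

variable {X H : Type*} [NormedAddCommGroup H] [InnerProductSpace ℝ H] [CompleteSpace H]
  [RKHS ℝ H X ℝ]

theorem inner_feature (h : H) (x : X) : ⟪h, feature H x⟫ = h x := by
  rw [feature, RKHS.inner_kerFun]
  simp

theorem inner_feature_feature (x t : X) :
    ⟪feature H x, feature H t⟫ = scalarKernel H x t := by
  rw [real_inner_comm, inner_feature, scalarKernel, feature, RKHS.kerFun_apply]

theorem norm_feature_le {κ : ℝ} (hκ : 0 ≤ κ) (hk : ∀ x, scalarKernel H x x ≤ κ ^ 2) (x : X) :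
    ‖feature H x‖ ≤ κ := by
  rw [← sq_le_sq₀ (norm_nonneg _) hκ, ← real_inner_self_eq_norm_sq, inner_feature_feature]
  exact hk x

variable (X H) in
theorem denseRange_linearCombination_feature :
    DenseRange (Finsupp.linearCombination ℝ (feature H : X → H)) := by
  have hle : Submodule.span ℝ {RKHS.kerFun H x v | (x : X) (v : ℝ)}
      ≤ LinearMap.range (Finsupp.linearCombination ℝ (feature H : X → H)) := by
    rw [Submodule.span_le]
    rintro _ ⟨x, v, rfl⟩
    refine ⟨Finsupp.single x v, ?_⟩
    rw [Finsupp.linearCombination_single, feature, ← map_smul, smul_eq_mul, mul_one]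
  refine fun v => closure_mono (fun w hw => hle hw) ?_
  rw [← Submodule.topologicalClosure_coe, RKHS.kerFun_dense]
  trivial

theorem separableSpace_of_stronglyMeasurable_feature [MeasurableSpace X]
    (hmeas : StronglyMeasurable (feature H : X → H)) : TopologicalSpace.SeparableSpace H := by
  have hsep := (hmeas.isSeparable_range.span (R := ℝ)).closure
  rw [← Finsupp.range_linearCombination, LinearMap.coe_range,
    (denseRange_linearCombination_feature X H).closure_eq] at hsep
  exact TopologicalSpace.isSeparable_univ_iff.mp hsep

end Feature

section KernelTensor

variable {X Y H G : Type*} [NormedAddCommGroup Y] [InnerProductSpace ℝ Y] [CompleteSpace Y]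
  [NormedAddCommGroup H] [InnerProductSpace ℝ H] [CompleteSpace H] [RKHS ℝ H X ℝ]
  [NormedAddCommGroup G] [InnerProductSpace ℝ G] [CompleteSpace G] [RKHS ℝ G X Y]

variable (X H G) in
/-- The bilinear map `H × Y → G` that sends `(k(x, ·), y)` to `K_x y`; if `G` has the kernel
`k Id`, it identifies `G` with the Hilbert tensor product of `H` and `Y`. -/
noncomputable def kernelTensor : H →L[ℝ] Y →L[ℝ] G :=
  (Finsupp.linearCombination ℝ (RKHS.kerFun G : X → Y →L[ℝ] G)).extendOfNorm
    (Finsupp.linearCombination ℝ (feature H))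

variable (hG : ∀ (x t : X) (y : Y), RKHS.kernel G x t y = scalarKernel H x t • y)
include hG

theorem inner_linearCombination_kerFun (c c' : X →₀ ℝ) (y y' : Y) :
    ⟪Finsupp.linearCombination ℝ (RKHS.kerFun G : X → Y →L[ℝ] G) c y,
      Finsupp.linearCombination ℝ (RKHS.kerFun G : X → Y →L[ℝ] G) c' y'⟫
      = ⟪Finsupp.linearCombination ℝ (feature H) c,
          Finsupp.linearCombination ℝ (feature H) c'⟫ * ⟪y, y'⟫ := by
  induction c using Finsupp.induction_linear with
  | zero => simp
  | add c₁ c₂ h₁ h₂ =>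
    rw [map_add, map_add, add_apply, inner_add_left, inner_add_left, h₁, h₂, add_mul]
  | single x a =>
    induction c' using Finsupp.induction_linear with
    | zero => simp
    | add c₁ c₂ h₁ h₂ =>
      rw [map_add, map_add, add_apply, inner_add_right, inner_add_right, h₁, h₂, add_mul]
    | single t b =>
      simp only [Finsupp.linearCombination_single, smul_apply, real_inner_smul_left,
        real_inner_smul_right]
      rw [← RKHS.kernel_inner, hG, real_inner_smul_left, real_inner_comm (feature H t),
        inner_feature_feature]
      ring

theorem kernelTensor_linearCombination_feature (c : X →₀ ℝ) :
    kernelTensor X H G (Finsupp.linearCombination ℝ (feature H) c)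
      = Finsupp.linearCombination ℝ (RKHS.kerFun G : X → Y →L[ℝ] G) c := by
  refine LinearMap.extendOfNorm_eq (denseRange_linearCombination_feature X H) ⟨1, fun c => ?_⟩ c
  rw [one_mul]
  refine ContinuousLinearMap.opNorm_le_bound _ (norm_nonneg _) fun y => ?_
  rw [← sq_le_sq₀ (norm_nonneg _) (by positivity), mul_pow]
  simp only [← real_inner_self_eq_norm_sq, inner_linearCombination_kerFun hG, le_refl]

theorem kernelTensor_feature (x : X) : kernelTensor X H G (feature H x) = RKHS.kerFun G x := by
  simpa using kernelTensor_linearCombination_feature hG (Finsupp.single x 1)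

theorem isTensor_kernelTensor : IsTensor (kernelTensor X H G) := fun h h' y y' => by
  refine (denseRange_linearCombination_feature X H).induction_on₂
    (p := fun h h' => ⟪kernelTensor X H G h y, kernelTensor X H G h' y'⟫ = ⟪h, h'⟫ * ⟪y, y'⟫)
    (isClosed_eq (by fun_prop) (by fun_prop)) (fun c c' => ?_) h h'
  simp only [kernelTensor_linearCombination_feature hG, inner_linearCombination_kerFun hG]

theorem kernelTensor_apply (h : H) (y : Y) (x : X) : kernelTensor X H G h y x = h x • y :=
  ext_inner_right ℝ fun y' => by
    rw [← RKHS.inner_kerFun, ← kernelTensor_feature hG, isTensor_kernelTensor hG, inner_feature,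
      real_inner_smul_left]

theorem hasSum_kernelTensor_of_apply_eq {ι : Type*} (u : HilbertBasis ι ℝ H) {T : H →L[ℝ] Y}
    (hT : IsHilbertSchmidt T) {f : G} (hf : ∀ x, f x = T (feature H x)) :
    HasSum (fun j => kernelTensor X H G (u j) (T (u j))) f := by
  have hsum := (isTensor_kernelTensor hG).summable u (hT.hasSum_norm_sq u).summable
  convert! hsum.hasSum
  refine RKHS.ext fun x => ?_
  have hx := (RKHS.kerFun G x).adjoint.hasSum hsum.hasSum
  simp only [RKHS.adjoint_kerFun, kernelTensor_apply hG] at hx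
  rw [hf]
  refine HasSum.unique ?_ hx
  simpa only [map_smul, inner_feature] using T.hasSum (hasSum_inner_smul u (feature H x))

end KernelTensor

section EmpiricalOperators

variable {E F E' ι : Type*} [NormedAddCommGroup E] [InnerProductSpace ℝ E]
  [NormedAddCommGroup F] [InnerProductSpace ℝ F] [NormedAddCommGroup E'] [InnerProductSpace ℝ E']
  {n : ℕ} (w : Fin n → ℝ) (h : Fin n → E) (y : Fin n → F)

/-- The weighted empirical cross covariance operator `(1/n) ∑ᵢ wᵢ yᵢ ⊗ hᵢ`; for `y = h` it is the
weighted empirical covariance operator. -/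
noncomputable def empCross : E →L[ℝ] F :=
  (n : ℝ)⁻¹ • ∑ i, w i • InnerProductSpace.rankOne ℝ (y i) (h i)

theorem empCross_apply (v : E) :
    empCross w h y v = (n : ℝ)⁻¹ • ∑ i, (w i * ⟪h i, v⟫) • y i := by
  simp [empCross, sum_apply, mul_smul]

theorem isPositive_empCross {w : Fin n → ℝ} (hw : ∀ i, 0 ≤ w i) (h : Fin n → E) :
    (empCross w h h).IsPositive := by
  refine .smul_of_nonneg (ContinuousLinearMap.isPositive_sum _ fun i _ => ?_) (by positivity)
  exact (InnerProductSpace.isPositive_rankOne_self (h i)).smul_of_nonneg (hw i)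

variable (F) in
theorem isCompactOperator_rankOne (x : F) (y : E) :
    IsCompactOperator (InnerProductSpace.rankOne ℝ x y) := by
  rw [InnerProductSpace.rankOne_def']
  exact (isCompactOperator_of_locallyCompactSpace_rng
    (ContinuousLinearMap.toSpanSingleton ℝ x)).comp_clm (innerSL ℝ y)

theorem isCompactOperator_empCross : IsCompactOperator (empCross w h y) :=
  Submodule.smul_mem (compactOperator (RingHom.id ℝ) E F) _ <| Submodule.sum_mem _ fun i _ =>
    Submodule.smul_mem _ (w i) (isCompactOperator_rankOne F (y i) (h i))

theorem norm_empCross_le {w : Fin n → ℝ} {h : Fin n → E} {y : Fin n → F} {b κ M : ℝ} (hb : 0 ≤ b)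
    (hκ : 0 ≤ κ) (hM : 0 ≤ M) (hw : ∀ i, |w i| ≤ b) (hh : ∀ i, ‖h i‖ ≤ κ) (hy : ∀ i, ‖y i‖ ≤ M) :
    ‖empCross w h y‖ ≤ b * (M * κ) := by
  rw [empCross, norm_smul, norm_inv, RCLike.norm_natCast]
  refine inv_mul_le_of_le_mul₀ n.cast_nonneg (by positivity) ?_
  refine (norm_sum_le_of_le _ fun i _ => ?_).trans_eq
    (by rw [Finset.sum_const, Finset.card_univ, Fintype.card_fin, nsmul_eq_mul])
  rw [norm_smul, InnerProductSpace.norm_rankOne, Real.norm_eq_abs]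
  gcongr
  exacts [hw i, hy i, hh i]

theorem comp_empCross (T : F →L[ℝ] E') : T ∘L empCross w h y = empCross w h (T ∘ y) := by
  ext v
  simp [empCross_apply, map_sum]

theorem empCross_comp [CompleteSpace E] [CompleteSpace E'] (T : E' →L[ℝ] E) :
    empCross w h y ∘L T = empCross w (T.adjoint ∘ h) y := by
  ext v
  simp [empCross_apply, ContinuousLinearMap.adjoint_inner_left]

theorem empCross_sub (y' : Fin n → F) :
    empCross w h (y - y') = empCross w h y - empCross w h y' := by
  ext v
  simp [empCross_apply, smul_sub, Finset.sum_sub_distrib]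

theorem hasSum_apply_empCross (A : E →L[ℝ] F →L[ℝ] E') (u : HilbertBasis ι ℝ E) :
    HasSum (fun j => A (u j) (empCross w h y (u j)))
      ((n : ℝ)⁻¹ • ∑ i, w i • A (h i) (y i)) := by
  simp only [empCross_apply, map_smul, map_sum]
  refine (hasSum_sum fun i _ => ?_).const_smul _
  convert! ((A.flip (y i)).hasSum (hasSum_inner_smul u (h i))).const_smul (w i) using 2 with j
  rw [ContinuousLinearMap.flip_apply, map_smul, smul_apply, real_inner_comm, mul_smul]

end EmpiricalOperators

section Estimator

variable {X Y H G ι : Type*} [NormedAddCommGroup Y] [InnerProductSpace ℝ Y] [CompleteSpace Y]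
  [NormedAddCommGroup H] [InnerProductSpace ℝ H] [CompleteSpace H] [RKHS ℝ H X ℝ]
  [NormedAddCommGroup G] [InnerProductSpace ℝ G] [CompleteSpace G] [RKHS ℝ G X Y]
  {n : ℕ} (w : Fin n → ℝ) (x : Fin n → X)

variable (G) in
/-- The operator `S* 𝓑 S` of the sample points `x` with `𝓑 = diag w`. -/
noncomputable def normalOp : G →L[ℝ] G := samplingAdj G x ∘L diagOp w ∘L samplingOp G x

theorem samplingAdj_diagOp_apply (y : Fin n → Y) :
    samplingAdj G x (diagOp w y) = (n : ℝ)⁻¹ • ∑ i, w i • RKHS.kerFun G (x i) (y i) := by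
  simp [samplingAdj, diagOp, sum_apply]

theorem normalOp_apply (f : G) :
    normalOp G w x f = (n : ℝ)⁻¹ • ∑ i, w i • RKHS.kerFun G (x i) (f (x i)) := by
  rw [normalOp, ContinuousLinearMap.comp_apply, ContinuousLinearMap.comp_apply,
    samplingAdj_diagOp_apply]
  simp [samplingOp]

theorem inner_samplingAdj_diagOp (f : G) (y : Fin n → Y) :
    ⟪f, samplingAdj G x (diagOp w y)⟫ = (n : ℝ)⁻¹ * ∑ i, w i * ⟪f (x i), y i⟫ := by
  simp only [samplingAdj_diagOp_apply, inner_sum, real_inner_smul_right, RKHS.inner_kerFun]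

theorem inner_normalOp (f f' : G) :
    ⟪f, normalOp G w x f'⟫ = (n : ℝ)⁻¹ * ∑ i, w i * ⟪f (x i), f' (x i)⟫ := by
  simp only [normalOp_apply, inner_sum, real_inner_smul_right, RKHS.inner_kerFun]

theorem isSymmetric_normalOp : (normalOp G w x : G →ₗ[ℝ] G).IsSymmetric := fun f f' => by
  rw [ContinuousLinearMap.coe_coe, real_inner_comm, inner_normalOp, inner_normalOp]
  simp only [real_inner_comm]

theorem normalOp_kernelTensor
    (hG : ∀ (x t : X) (y : Y), RKHS.kernel G x t y = scalarKernel H x t • y) (h : H) (y : Y) :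
    normalOp G w x (kernelTensor X H G h y)
      = kernelTensor X H G (empCross w (feature H ∘ x) (feature H ∘ x) h) y := by
  rw [normalOp_apply, empCross_apply, map_smul, map_sum, smul_apply, sum_apply]
  refine congrArg _ (Finset.sum_congr rfl fun i _ => ?_)
  rw [kernelTensor_apply hG, map_smul, map_smul, smul_apply, Function.comp_apply,
    kernelTensor_feature hG, real_inner_comm, inner_feature, mul_smul]

variable {w}

theorem starProjection_ker_normalOp (hw : ∀ i, 0 ≤ w i) (y : Fin n → Y) :
    (normalOp G w x).ker.starProjection (samplingAdj G x (diagOp w y)) = 0 := by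
  rw [Submodule.starProjection_apply_eq_zero_iff, Submodule.mem_orthogonal]
  intro f hf
  have hzero := inner_normalOp w x f f
  rw [show normalOp G w x f = 0 from hf, inner_zero_right, eq_comm, mul_eq_zero,
    Finset.sum_eq_zero_iff_of_nonneg fun i _ => mul_nonneg (hw i) real_inner_self_nonneg] at hzero
  rw [inner_samplingAdj_diagOp, mul_eq_zero]
  refine hzero.imp_right fun hvanish => Finset.sum_eq_zero fun i hi => ?_
  rcases mul_eq_zero.mp (hvanish i hi) with hi | hi
  · rw [hi, zero_mul]
  · rw [inner_self_eq_zero.mp hi, inner_zero_left, mul_zero]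

theorem estimator_congr {β : X → ℝ} (hβ : ∀ x, 0 ≤ β x) {gl gl' : ℝ → ℝ}
    (hgl : Set.EqOn gl gl' {0}ᶜ) (z : Fin n → X × Y) :
    estimator G β gl z = estimator G β gl' z :=
  funcCalc_congr_of_starProjection_ker_eq_zero hgl
    (starProjection_ker_normalOp _ (fun i => hβ (z i).1) fun i => (z i).2)

variable (hG : ∀ (x t : X) (y : Y), RKHS.kernel G x t y = scalarKernel H x t • y)
  {β : X → ℝ} {gl : ℝ → ℝ} (z : Fin n → X × Y)

variable (H) in
/-- The reweighted empirical covariance operator of the features of the sample `z`. -/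
noncomputable def sampleCov (β : X → ℝ) (z : Fin n → X × Y) : H →L[ℝ] H :=
  empCross (fun i => β (z i).1) (fun i => feature H (z i).1) fun i => feature H (z i).1

variable (H) in
/-- The reweighted empirical cross covariance operator of the sample `z`. -/
noncomputable def sampleCross (β : X → ℝ) (z : Fin n → X × Y) : H →L[ℝ] Y :=
  empCross (fun i => β (z i).1) (fun i => feature H (z i).1) fun i => (z i).2

include hG

theorem hasSum_estimator (d : PosEigenbasis ι (sampleCov H β z)) (hgl : d.Bdd gl) :
    HasSum (fun j => kernelTensor X H G (d.basis j)
      ((sampleCross H β z ∘L d.func gl) (d.basis j))) (estimator G β gl z) := by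
  have hA := isTensor_kernelTensor hG
  have heigen (j : ι) (y : Y) :
      normalOp G (fun i => β (z i).1) (fun i => (z i).1) (kernelTensor X H G (d.basis j) y)
        = d.eigenvalue j • kernelTensor X H G (d.basis j) y := by
    rw [normalOp_kernelTensor _ _ hG, ← smul_apply, ← map_smul]
    exact congrArg (kernelTensor X H G · y) (d.apply_basis j)
  have hcross := hasSum_apply_empCross (fun i => β (z i).1) (fun i => feature H (z i).1)
    (fun i => (z i).2) (kernelTensor X H G) d.basis
  simp only [kernelTensor_feature hG] at hcross
  rw [← samplingAdj_diagOp_apply] at hcross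
  have hHS := (hA.hsNorm_eq_norm d.basis hcross).1.comp (d.func gl)
  have hsum := (hA.summable d.basis (hHS.1.hasSum_norm_sq d.basis).summable).hasSum
  convert! hsum
  refine funcCalc_eq_of_hasSum (isSymmetric_normalOp _ _) gl (fun j => heigen j _) hcross ?_
  convert! hsum using 2 with j
  rw [ContinuousLinearMap.comp_apply, PosEigenbasis.func_apply_basis hgl, map_smul, map_smul]

theorem norm_sub_estimator_eq (d : PosEigenbasis ι (sampleCov H β z)) (hgl : d.Bdd gl)
    {T : H →L[ℝ] Y} (hT : IsHilbertSchmidt T) {f : G} (hf : ∀ x, f x = T (feature H x)) :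
    ‖f - estimator G β gl z‖ = hsNorm (T - sampleCross H β z ∘L d.func gl) := by
  have hdiff := (hasSum_kernelTensor_of_apply_eq hG d.basis hT hf).sub
    (hasSum_estimator hG z d hgl)
  simp only [← map_sub, ← sub_apply] at hdiff
  exact ((isTensor_kernelTensor hG).hsNorm_eq_norm d.basis hdiff).2.symm

end Estimator

section SecondMoment

variable {Ω E F ι : Type*} [MeasurableSpace Ω] {μ : Measure Ω}
  [NormedAddCommGroup E] [InnerProductSpace ℝ E]
  [NormedAddCommGroup F] [InnerProductSpace ℝ F] {ψ : Ω → E}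

/-- The second moment operator `∫ ψ ⊗ ψ dμ`; the covariance operator `covOp H q` is
`secondMoment q (feature H)`. -/
noncomputable def secondMoment (μ : Measure Ω) (ψ : Ω → E) : E →L[ℝ] E :=
  ∫ x, InnerProductSpace.rankOne ℝ (ψ x) (ψ x) ∂μ

theorem integrable_rankOne_self (hψ : MemLp ψ 2 μ) :
    Integrable (fun x => InnerProductSpace.rankOne ℝ (ψ x) (ψ x)) μ := by
  have hcont : Continuous fun v : E => InnerProductSpace.rankOne ℝ v v :=
    (InnerProductSpace.rankOne ℝ).continuous.clm_apply continuous_id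
  refine (hψ.integrable_norm_pow two_ne_zero).mono'
    (hcont.comp_aestronglyMeasurable hψ.1) (ae_of_all _ fun x => ?_)
  rw [InnerProductSpace.norm_rankOne, sq]

variable [CompleteSpace E]

theorem inner_secondMoment (hψ : MemLp ψ 2 μ) (v w : E) :
    ⟪v, secondMoment μ ψ w⟫ = ∫ x, ⟪ψ x, v⟫ * ⟪ψ x, w⟫ ∂μ := by
  have hint := integrable_rankOne_self hψ
  rw [secondMoment, ContinuousLinearMap.integral_apply hint,
    ← integral_inner (hint.apply_continuousLinearMap w)]
  simp only [InnerProductSpace.rankOne_apply, real_inner_smul_right, real_inner_comm v, mul_comm]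

theorem isPositive_secondMoment (hψ : MemLp ψ 2 μ) : (secondMoment μ ψ).IsPositive := by
  refine (ContinuousLinearMap.isPositive_def').mpr ⟨?_, fun v => ?_⟩
  · refine ContinuousLinearMap.isSelfAdjoint_iff_isSymmetric.mpr fun v w => ?_
    rw [ContinuousLinearMap.coe_coe, real_inner_comm, inner_secondMoment hψ, inner_secondMoment hψ]
    simp only [mul_comm]
  · rw [ContinuousLinearMap.reApplyInnerSelf_apply, real_inner_comm, inner_secondMoment hψ]
    exact integral_nonneg fun x => mul_self_nonneg _

theorem isCompactOperator_secondMoment [IsFiniteMeasure μ] (hψ : MemLp ψ 2 μ) :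
    IsCompactOperator (secondMoment μ ψ) := by
  rcases eq_zero_or_neZero μ with rfl | _
  · rw [secondMoment, integral_zero_measure]
    exact isCompactOperator_zero
  · have haverage : (⨍ x, InnerProductSpace.rankOne ℝ (ψ x) (ψ x) ∂μ) ∈
        (compactOperator (RingHom.id ℝ) E E : Set (E →L[ℝ] E)) :=
      (compactOperator (RingHom.id ℝ) E E).convex.average_mem isClosed_setOfPred_isCompactOperator
        (ae_of_all _ fun x => isCompactOperator_rankOne _ _ _) (integrable_rankOne_self hψ)
    rw [secondMoment, ← measure_smul_average]
    exact Submodule.smul_mem (compactOperator (RingHom.id ℝ) E E) _ haverage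

omit [CompleteSpace E] in
theorem norm_secondMoment_le [IsFiniteMeasure μ] {κ : ℝ} (hψ : ∀ x, ‖ψ x‖ ≤ κ) :
    ‖secondMoment μ ψ‖ ≤ κ ^ 2 * μ.real Set.univ := by
  refine norm_integral_le_of_norm_le_const (ae_of_all _ fun x => ?_)
  rw [InnerProductSpace.norm_rankOne, ← sq]
  exact pow_le_pow_left₀ (norm_nonneg _) (hψ x) 2

theorem comp_secondMoment_comp_adjoint [CompleteSpace F] (hψ : MemLp ψ 2 μ) (S : E →L[ℝ] F) :
    S ∘L secondMoment μ ψ ∘L S.adjoint = secondMoment μ (S ∘ ψ) := by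
  refine ContinuousLinearMap.ext fun w => ext_inner_left ℝ fun v => ?_
  rw [inner_secondMoment (S.comp_memLp' hψ), ContinuousLinearMap.comp_apply,
    ← ContinuousLinearMap.adjoint_inner_left, ContinuousLinearMap.comp_apply,
    inner_secondMoment hψ]
  simp only [ContinuousLinearMap.adjoint_inner_right, Function.comp_apply]

theorem trace_secondMoment [TopologicalSpace.SeparableSpace E] (hψ : MemLp ψ 2 μ) :
    trace (secondMoment μ ψ) = ∫ x, ‖ψ x‖ ^ 2 ∂μ := by
  have := countable_of_hilbertBasis (onb E)
  have hpointwise (x : Ω) : HasSum (fun i => ⟪ψ x, onb E i⟫ * ⟪ψ x, onb E i⟫) (‖ψ x‖ ^ 2) := by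
    simpa only [sq, real_inner_comm (ψ x)] using hasSum_inner_sq (onb E) (ψ x)
  have hmeas (i : basisIndex E) :
      AEStronglyMeasurable (fun x => ⟪ψ x, onb E i⟫ * ⟪ψ x, onb E i⟫) μ :=
    (hψ.1.inner aestronglyMeasurable_const).mul (hψ.1.inner aestronglyMeasurable_const)
  simp only [trace, inner_secondMoment hψ]
  refine (hasSum_integral_of_dominated_convergence _ hmeas
    (fun i => ae_of_all _ fun x => (Real.norm_of_nonneg (mul_self_nonneg _)).le)
    (ae_of_all _ fun x => (hpointwise x).summable) ?_ (ae_of_all _ hpointwise)).tsum_eq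
  simpa only [(hpointwise _).tsum_eq] using hψ.integrable_norm_pow two_ne_zero

namespace PosEigenbasis

theorem adjoint_shiftPow {C : E →L[ℝ] E} (d : PosEigenbasis ι C) {lam : ℝ} (hlam : 0 < lam)
    (r : ℝ) : (d.shiftPow lam r).adjoint = d.shiftPow lam r :=
  ((ContinuousLinearMap.eq_adjoint_iff _ _).mpr (inner_func_left (d.bdd_shiftPow hlam r))).symm

omit [CompleteSpace E] in
theorem ring_inverse_add_smul_one {C : E →L[ℝ] E} (d : PosEigenbasis ι C) {lam : ℝ}
    (hlam : 0 < lam) : Ring.inverse (C + lam • (1 : E →L[ℝ] E)) = d.shiftPow lam (-1) := by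
  have hright := d.shiftPow_mul_shiftPow_neg hlam 1
  have hleft := d.shiftPow_neg_mul_shiftPow hlam 1
  rw [d.shiftPow_one hlam] at hright hleft
  exact Ring.inverse_unit ⟨_, _, hright, hleft⟩

omit [CompleteSpace E] in
theorem commute_shiftPow {C : E →L[ℝ] E} (d : PosEigenbasis ι C) {lam : ℝ} (hlam : 0 < lam)
    (r : ℝ) : Commute C (d.shiftPow lam r) := by
  refine ext_basis d.basis fun i => ?_
  rw [mul_apply_eq_comp, mul_apply_eq_comp, d.apply_basis, map_smul, shiftPow,
    func_apply_basis (d.bdd_shiftPow hlam r), map_smul, d.apply_basis, smul_comm]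

omit [CompleteSpace E] in
theorem mul_shiftPow_neg_one {C : E →L[ℝ] E} (d : PosEigenbasis ι C) {lam : ℝ} (hlam : 0 < lam) :
    C * d.shiftPow lam (-1)
      = d.shiftPow lam (-(1 / 2)) * (C * d.shiftPow lam (-(1 / 2))) := by
  rw [← mul_assoc, ← (d.commute_shiftPow hlam _).eq, mul_assoc, d.shiftPow_mul_shiftPow hlam]
  norm_num

end PosEigenbasis

theorem effDim_secondMoment [TopologicalSpace.SeparableSpace E] (hψ : MemLp ψ 2 μ)
    (d : PosEigenbasis ι (secondMoment μ ψ)) {lam : ℝ} (hlam : 0 < lam) :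
    effDim (secondMoment μ ψ) lam = ∫ x, ‖d.shiftPow lam (-(1 / 2)) (ψ x)‖ ^ 2 ∂μ := by
  have hsandwich := comp_secondMoment_comp_adjoint hψ (d.shiftPow lam (-(1 / 2)))
  rw [d.adjoint_shiftPow hlam] at hsandwich
  rw [effDim, d.ring_inverse_add_smul_one hlam, d.mul_shiftPow_neg_one hlam]
  exact (congrArg trace hsandwich).trans
    (trace_secondMoment ((d.shiftPow lam (-(1 / 2))).comp_memLp' hψ))

end SecondMoment

theorem isCenteredBounded_sub_integral {Ω K : Type*} [MeasurableSpace Ω] {μ : Measure Ω}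
    [IsProbabilityMeasure μ] [NormedAddCommGroup K] [InnerProductSpace ℝ K] [CompleteSpace K]
    {ζ : Ω → K} {L v : ℝ} (hζ : StronglyMeasurable ζ) (hL : ∀ᵐ ω ∂μ, ‖ζ ω‖ ≤ L)
    (hv : ∫ ω, ‖ζ ω‖ ^ 2 ∂μ ≤ v) :
    IsCenteredBounded μ (fun ω => ζ ω - ∫ ω, ζ ω ∂μ) (2 * L) v := by
  have hint : Integrable ζ μ := .of_bound hζ.aestronglyMeasurable L hL
  have hint_sq : Integrable (fun ω => ‖ζ ω‖ ^ 2) μ :=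
    (MemLp.of_bound hζ.aestronglyMeasurable L hL).integrable_norm_pow two_ne_zero
  set m := ∫ ω, ζ ω ∂μ with hm
  have hmL : ‖m‖ ≤ L := by simpa using norm_integral_le_of_norm_le_const hL
  refine ⟨hζ.sub stronglyMeasurable_const, ?_, ?_, hv.trans' ?_⟩
  · filter_upwards [hL] with ω hω
    linarith [norm_sub_le (ζ ω) m]
  · rw [integral_sub hint (integrable_const _), integral_const, probReal_univ, one_smul, sub_self]
  · have hinner : Integrable (fun ω => 2 * ⟪m, ζ ω⟫) μ := (hint.const_inner m).const_mul 2
    calc ∫ ω, ‖ζ ω - m‖ ^ 2 ∂μ = ∫ ω, (‖ζ ω‖ ^ 2 - 2 * ⟪m, ζ ω⟫ + ‖m‖ ^ 2) ∂μ := by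
          simp only [norm_sub_sq_real, real_inner_comm m]
      _ = ∫ ω, ‖ζ ω‖ ^ 2 ∂μ - ‖m‖ ^ 2 := by
          rw [integral_add (f := fun ω => ‖ζ ω‖ ^ 2 - 2 * ⟪m, ζ ω⟫) (hint_sq.sub hinner)
              (integrable_const _), integral_sub hint_sq hinner, integral_const_mul,
            integral_inner hint, ← hm, real_inner_self_eq_norm_sq, integral_const, probReal_univ,
            one_smul]
          ring
      _ ≤ ∫ ω, ‖ζ ω‖ ^ 2 ∂μ := sub_le_self _ (sq_nonneg _)

section Reweighting

variable {X Y : Type*} [MeasurableSpace X] [MeasurableSpace Y] {pX qX : Measure X}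
  {P : Kernel X Y} {β : X → ℝ} {b : ℝ}
  (hq : qX = pX.withDensity fun x => ENNReal.ofReal (β x))

include hq

theorem real_univ_le_of_reweighting [IsProbabilityMeasure pX] (hβ : ∀ x, β x ≤ b) (hb : 0 ≤ b) :
    qX.real Set.univ ≤ b := by
  refine ENNReal.toReal_le_of_le_ofReal hb ?_
  rw [hq, withDensity_apply _ MeasurableSet.univ, Measure.restrict_univ]
  calc ∫⁻ x, ENNReal.ofReal (β x) ∂pX ≤ ∫⁻ _, ENNReal.ofReal b ∂pX :=
        lintegral_mono fun x => ENNReal.ofReal_le_ofReal (hβ x)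
    _ = ENNReal.ofReal b := by rw [lintegral_const, measure_univ, mul_one]

theorem isFiniteMeasure_of_reweighting [IsFiniteMeasure pX] (hβ : ∀ x, β x ≤ b) :
    IsFiniteMeasure qX := by
  subst hq
  refine isFiniteMeasure_withDensity (ne_top_of_le_ne_top ?_
    (lintegral_mono fun x => ENNReal.ofReal_le_ofReal (hβ x)))
  rw [lintegral_const]
  finiteness

variable (hβmeas : Measurable β) (hβ : ∀ x, 0 ≤ β x)

include hβmeas hβ

theorem integral_reweighting {E : Type*} [NormedAddCommGroup E] [NormedSpace ℝ E] [SFinite pX]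
    [IsMarkovKernel P] {f : X → E} (hf : StronglyMeasurable f) :
    ∫ x, f x ∂qX = ∫ z, β z.1 • f z.1 ∂(pX ⊗ₘ P) := by
  calc ∫ x, f x ∂qX = ∫ x, β x • f x ∂pX := by
        rw [hq, integral_withDensity_eq_integral_toReal_smul hβmeas.ennreal_ofReal
          (ae_of_all _ fun x => ENNReal.ofReal_lt_top)]
        simp only [ENNReal.toReal_ofReal (hβ _)]
    _ = ∫ x, β x • f x ∂(pX ⊗ₘ P).map Prod.fst := by
        rw [← Measure.fst, Measure.fst_compProd]
    _ = ∫ z, β z.1 • f z.1 ∂(pX ⊗ₘ P) :=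
        integral_map measurable_fst.aemeasurable
          (hβmeas.stronglyMeasurable.smul hf).aestronglyMeasurable

theorem integral_smul_residual_eq_zero {F K : Type*} [NormedAddCommGroup F] [NormedSpace ℝ F]
    [CompleteSpace F] [NormedAddCommGroup K] [NormedSpace ℝ K] [CompleteSpace K] [SFinite pX]
    [IsMarkovKernel P] {r : Y → F} (hr : Integrable (fun z => r z.2) (pX ⊗ₘ P)) {m : X → F}
    (hreg : ∀ᵐ x ∂qX, m x = ∫ y, r y ∂(P x)) (L : X → F →L[ℝ] K)
    (hint : Integrable (fun z => β z.1 • L z.1 (r z.2 - m z.1)) (pX ⊗ₘ P)) :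
    ∫ z, β z.1 • L z.1 (r z.2 - m z.1) ∂(pX ⊗ₘ P) = 0 := by
  rw [hq, ae_withDensity_iff hβmeas.ennreal_ofReal] at hreg
  rw [Measure.integral_compProd hint]
  refine integral_eq_zero_of_ae ?_
  filter_upwards [hreg, ((Measure.integrable_compProd_iff hr.aestronglyMeasurable).mp hr).1]
    with x hx hrx
  have hsub : Integrable (fun y => r y - m x) (P x) := hrx.sub (integrable_const _)
  rw [Pi.zero_apply, integral_smul, (L x).integral_comp_comm hsub,
    integral_sub hrx (integrable_const _), integral_const, probReal_univ, one_smul]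
  rcases (hβ x).eq_or_lt with hzero | hpos
  · rw [← hzero, zero_smul]
  · rw [← hx (ENNReal.ofReal_pos.mpr hpos).ne', sub_self, map_zero, smul_zero]

end Reweighting

section RepresentingTensors

variable {E F K : Type*} [NormedAddCommGroup E] [InnerProductSpace ℝ E] [CompleteSpace E]
  [NormedAddCommGroup F] [InnerProductSpace ℝ F] [CompleteSpace F]
  [NormedAddCommGroup K] [InnerProductSpace ℝ K] {n : ℕ}

theorem norm_mul_empCross_self_sub_le {A : E →L[ℝ] E →L[ℝ] K} (hA : IsTensor A) (w : Fin n → ℝ)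
    (h : Fin n → E) {C D : E →L[ℝ] E} (hC : C.adjoint = C) (hD : D.adjoint = D) {k : K}
    (hk : ∀ u v, ⟪k, A u v⟫ = ⟪C (D u), v⟫) :
    ‖D * (empCross w h h - C)‖ ≤ ‖(n : ℝ)⁻¹ • ∑ i, w i • A (D (h i)) (h i) - k‖ := by
  have hadj : (empCross w h h).adjoint = empCross w h h := by
    simp [empCross, map_sum]
  have hT : D * (empCross w h h - C) = ((empCross w h h - C) ∘L D).adjoint := by
    rw [ContinuousLinearMap.adjoint_comp, map_sub, hadj, hC, hD, ContinuousLinearMap.mul_def]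
  rw [hT, LinearIsometryEquiv.norm_map]
  refine hA.opNorm_le_of_inner fun u v => ?_
  have hsymm (x : E) : ⟪D x, u⟫ = ⟪x, D u⟫ := by
    rw [← ContinuousLinearMap.adjoint_inner_right, hD]
  simp only [inner_sub_left, hk, real_inner_smul_left, sum_inner, hA _ _ _ _, hsymm,
    ContinuousLinearMap.comp_apply, sub_apply, empCross_apply, mul_assoc]

theorem hsNorm_empCross_sub_comp {A : E →L[ℝ] F →L[ℝ] K} (hA : IsTensor A)
    (w : Fin n → ℝ) (h : Fin n → E) (y : Fin n → F) (S : E →L[ℝ] F) (D : E →L[ℝ] E) :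
    IsHilbertSchmidt ((empCross w h y - S ∘L empCross w h h) ∘L D) ∧
      hsNorm ((empCross w h y - S ∘L empCross w h h) ∘L D)
        = ‖(n : ℝ)⁻¹ • ∑ i, w i • A (D.adjoint (h i)) (y i - S (h i))‖ := by
  rw [comp_empCross, ← empCross_sub, empCross_comp]
  exact hA.hsNorm_eq_norm (onb E) (hasSum_apply_empCross _ _ _ A (onb E))

theorem inner_integral_tensor [CompleteSpace K] {Ω : Type*} [MeasurableSpace Ω] {μ : Measure Ω}
    {ψ : Ω → E} (hψ : MemLp ψ 2 μ) {A : E →L[ℝ] E →L[ℝ] K} (hA : IsTensor A) {D : E →L[ℝ] E}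
    (hD : D.adjoint = D) (u v : E) :
    ⟪∫ x, A (D (ψ x)) (ψ x) ∂μ, A u v⟫ = ⟪secondMoment μ ψ (D u), v⟫ := by
  have hmeas : AEStronglyMeasurable (fun x => A (D (ψ x)) (ψ x)) μ := by
    have hcont : Continuous fun e : E => A (D e) e := by fun_prop
    exact hcont.comp_aestronglyMeasurable hψ.aestronglyMeasurable
  have hint : Integrable (fun x => A (D (ψ x)) (ψ x)) μ := by
    refine ((hψ.integrable_norm_pow two_ne_zero).const_mul ‖D‖).mono' hmeas ?_
    refine ae_of_all _ fun x => ?_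
    rw [hA.norm_apply, sq, ← mul_assoc]
    exact mul_le_mul_of_nonneg_right (D.le_opNorm _) (norm_nonneg _)
  rw [real_inner_comm, ← integral_inner hint, real_inner_comm, inner_secondMoment hψ]
  refine integral_congr_ae (ae_of_all _ fun x => ?_)
  simp only [hA _ _ _ _]
  rw [← hD, ContinuousLinearMap.adjoint_inner_right, real_inner_comm, mul_comm, real_inner_comm v,
    hD]

end RepresentingTensors

section Moments

variable {X Y E F K : Type*} [MeasurableSpace X] [MeasurableSpace Y]
  [NormedAddCommGroup E] [InnerProductSpace ℝ E] [NormedAddCommGroup F] [InnerProductSpace ℝ F]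
  [NormedAddCommGroup K] [InnerProductSpace ℝ K] {A : E →L[ℝ] F →L[ℝ] K} {b c d : ℝ}

theorem IsTensor.norm_smul_apply_le (hA : IsTensor A) {w : ℝ} (hw : w ∈ Set.Icc 0 b) {h : E}
    (hh : ‖h‖ ≤ d) {y : F} (hy : ‖y‖ ≤ c) : ‖w • A h y‖ ≤ b * (d * c) := by
  rw [norm_smul, hA.norm_apply, Real.norm_of_nonneg hw.1]
  have hb := hw.1.trans hw.2
  have hd := (norm_nonneg h).trans hh
  gcongr
  exact hw.2

theorem IsTensor.norm_sq_smul_apply_le (hA : IsTensor A) {w : ℝ} (hw : w ∈ Set.Icc 0 b) (h : E)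
    {y : F} (hy : ‖y‖ ≤ c) : ‖w • A h y‖ ^ 2 ≤ b * c ^ 2 * (w * ‖h‖ ^ 2) := by
  have hb := hw.1.trans hw.2
  have hw0 := hw.1
  calc ‖w • A h y‖ ^ 2 = w * ‖y‖ ^ 2 * (w * ‖h‖ ^ 2) := by
        rw [norm_smul, hA.norm_apply, Real.norm_of_nonneg hw.1]
        ring
    _ ≤ b * c ^ 2 * (w * ‖h‖ ^ 2) := by
        gcongr
        exact hw.2

variable {pX qX : Measure X} [IsProbabilityMeasure pX] {P : Kernel X Y} [IsMarkovKernel P]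
  {β : X → ℝ} {u : X → E} (hq : qX = pX.withDensity fun x => ENNReal.ofReal (β x))
  (hβmeas : Measurable β) (hβ : ∀ x, β x ∈ Set.Icc 0 b) (hu : StronglyMeasurable u)
  (hd : ∀ x, ‖u x‖ ≤ d) (hA : IsTensor A)

include hq hβmeas hβ hu hd hA

theorem integral_norm_sq_smul_tensor_le {r : X × Y → F} (hr : ∀ᵐ z ∂(pX ⊗ₘ P), ‖r z‖ ≤ c) :
    ∫ z, ‖β z.1 • A (u z.1) (r z)‖ ^ 2 ∂(pX ⊗ₘ P) ≤ b * c ^ 2 * ∫ x, ‖u x‖ ^ 2 ∂qX := by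
  rw [integral_reweighting (P := P) (f := fun x => ‖u x‖ ^ 2) hq hβmeas (fun x => (hβ x).1)
    (hu.norm.pow 2), ← integral_const_mul]
  have hmeas : StronglyMeasurable fun z : X × Y => β z.1 * ‖u z.1‖ ^ 2 :=
    (hβmeas.stronglyMeasurable.mul (hu.norm.pow 2)).comp_measurable measurable_fst
  refine integral_mono_of_nonneg (ae_of_all _ fun z => sq_nonneg _) (.const_mul ?_ _) ?_
  · refine .of_bound hmeas.aestronglyMeasurable (b * d ^ 2) (ae_of_all _ fun z => ?_)
    obtain ⟨h0, hb⟩ := hβ z.1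
    rw [smul_eq_mul, norm_mul, norm_pow, norm_norm, Real.norm_of_nonneg h0]
    gcongr
    exacts [h0.trans hb, hd z.1]
  · filter_upwards [hr] with z hz using hA.norm_sq_smul_apply_le (hβ z.1) _ hz

variable [CompleteSpace K]

theorem isCenteredBounded_reweighted_residual [CompleteSpace F] {r : Y → F}
    (hr : StronglyMeasurable r) {f : X → F} (hf : StronglyMeasurable f)
    (hreg : ∀ᵐ x ∂qX, f x = ∫ y, r y ∂(P x)) {M' m : ℝ}
    (hM' : ∀ᵐ z ∂(pX ⊗ₘ P), ‖r z.2‖ ≤ M') (hm : ∀ x, ‖f x‖ ≤ m) :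
    IsCenteredBounded (pX ⊗ₘ P) (fun z => β z.1 • A (u z.1) (r z.2 - f z.1))
      (b * (d * (M' + m))) (b * (M' + m) ^ 2 * ∫ x, ‖u x‖ ^ 2 ∂qX) := by
  have hrsnd : StronglyMeasurable fun z : X × Y => r z.2 := hr.comp_measurable measurable_snd
  have hcont : Continuous fun p : E × F => A p.1 p.2 := by fun_prop
  have hmeas : StronglyMeasurable fun z : X × Y => β z.1 • A (u z.1) (r z.2 - f z.1) :=
    (hβmeas.comp measurable_fst).stronglyMeasurable.smul (hcont.comp_stronglyMeasurable
      ((hu.comp_measurable measurable_fst).prodMk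
        (hrsnd.sub (hf.comp_measurable measurable_fst))))
  have hres : ∀ᵐ z ∂(pX ⊗ₘ P), ‖r z.2 - f z.1‖ ≤ M' + m := by
    filter_upwards [hM'] with z hz using norm_sub_le_of_le hz (hm z.1)
  have hbound : ∀ᵐ z ∂(pX ⊗ₘ P), ‖β z.1 • A (u z.1) (r z.2 - f z.1)‖ ≤ b * (d * (M' + m)) := by
    filter_upwards [hres] with z hz using hA.norm_smul_apply_le (hβ z.1) (hd z.1) hz
  exact ⟨hmeas, hbound,
    integral_smul_residual_eq_zero hq hβmeas (fun x => (hβ x).1)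
      (.of_bound hrsnd.aestronglyMeasurable M' hM') hreg (fun x => A (u x))
      (.of_bound hmeas.aestronglyMeasurable _ hbound),
    integral_norm_sq_smul_tensor_le hq hβmeas hβ hu hd hA hres⟩

theorem isCenteredBounded_reweighted_sub_integral {f : X → F} (hf : StronglyMeasurable f)
    (hc : ∀ x, ‖f x‖ ≤ c) :
    IsCenteredBounded (pX ⊗ₘ P) (fun z => β z.1 • A (u z.1) (f z.1) - ∫ x, A (u x) (f x) ∂qX)
      (2 * (b * (d * c))) (b * c ^ 2 * ∫ x, ‖u x‖ ^ 2 ∂qX) := by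
  have hcont : Continuous fun p : E × F => A p.1 p.2 := by fun_prop
  have htensor : StronglyMeasurable fun x => A (u x) (f x) :=
    hcont.comp_stronglyMeasurable (hu.prodMk hf)
  rw [integral_reweighting (P := P) hq hβmeas (fun x => (hβ x).1) htensor]
  exact isCenteredBounded_sub_integral
    ((hβmeas.stronglyMeasurable.smul htensor).comp_measurable measurable_fst)
    (ae_of_all _ fun z => hA.norm_smul_apply_le (hβ z.1) (hd z.1) (hc z.1))
    (integral_norm_sq_smul_tensor_le hq hβmeas hβ hu hd hA (ae_of_all _ fun z => hc z.1))

end Moments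

section FilterFunctions

variable {s : ℝ} {g : ℝ → ℝ → ℝ} {φ : ℝ → ℝ} {D B γ ν γν c lam t : ℝ}

theorem IsIndexFunction.mono (hφ : IsIndexFunction φ) {t' : ℝ} (ht : 0 ≤ t) (h : t ≤ t') :
    φ t ≤ φ t' :=
  hφ.strictMonoOn.monotoneOn ht (ht.trans h) h

theorem IsIndexFunction.nonneg (hφ : IsIndexFunction φ) (ht : 0 ≤ t) : 0 ≤ φ t :=
  hφ.map_zero.symm.trans_le (hφ.mono le_rfl ht)

theorem IsIndexFunction.pos (hφ : IsIndexFunction φ) (ht : 0 < t) : 0 < φ t :=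
  hφ.map_zero.symm.trans_lt (hφ.strictMonoOn (Set.mem_Ici.mpr le_rfl) ht.le ht)

theorem Covers.mul_rpow_le (hc : Covers s ν φ c) (hφ : IsIndexFunction φ)
    (hlam : lam ∈ Set.Ioc 0 s) (ht : t ∈ Set.Icc lam s) :
    φ t * lam ^ ν ≤ 1 / c * φ lam * t ^ ν := by
  have hc0 := hc.1
  have hcover := hc.2 lam hlam t ht
  rw [← mul_div_assoc, div_le_div_iff₀ (hφ.pos hlam.1) (hφ.pos (hlam.1.trans_le ht.1))] at hcover
  rw [one_div_mul_eq_div, div_mul_eq_mul_div, le_div_iff₀ hc0]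
  linarith

theorem Covers.abs_mul_rpow_neg_le (hc : Covers s ν φ c) (hφ : IsIndexFunction φ) (hν : 0 ≤ ν)
    (hlam : lam ∈ Set.Ioc 0 s) (ht : t ∈ Set.Icc 0 s) :
    |φ t| * (t + lam) ^ (-ν) ≤ max 1 (1 / c) * φ lam * lam ^ (-ν) := by
  have hlam0 := hlam.1
  have ht0 := ht.1
  have hφlam := hφ.pos hlam0
  have hsum : 0 < t + lam := by positivity
  rw [abs_of_nonneg (hφ.nonneg ht0), Real.rpow_neg hsum.le, Real.rpow_neg hlam0.le,
    ← div_eq_mul_inv, ← div_eq_mul_inv, div_le_div_iff₀ (by positivity) (by positivity)]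
  rcases le_total t lam with h | h
  · calc φ t * lam ^ ν ≤ 1 * φ lam * (t + lam) ^ ν := by
          rw [one_mul]
          gcongr
          exacts [hφ.mono ht0 h, le_add_of_nonneg_left ht0]
      _ ≤ _ := by gcongr; exact le_max_left _ _
  · calc φ t * lam ^ ν ≤ 1 / c * φ lam * t ^ ν := hc.mul_rpow_le hφ hlam ⟨h, ht.2⟩
      _ ≤ max 1 (1 / c) * φ lam * (t + lam) ^ ν := by
          gcongr
          exacts [le_max_right _ _, le_add_of_nonneg_right hlam0.le]

theorem add_rpow_le_two_rpow_mul {x y : ℝ} (hx : 0 ≤ x) (hy : 0 ≤ y) (hν : 0 ≤ ν) :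
    (x + y) ^ ν ≤ 2 ^ ν * (x ^ ν + y ^ ν) := by
  rcases le_total x y with h | h
  · calc (x + y) ^ ν ≤ (2 * y) ^ ν := by gcongr; linarith
      _ = 2 ^ ν * y ^ ν := Real.mul_rpow two_pos.le hy
      _ ≤ 2 ^ ν * (x ^ ν + y ^ ν) := by gcongr; exact le_add_of_nonneg_left (by positivity)
  · calc (x + y) ^ ν ≤ (2 * x) ^ ν := by gcongr; linarith
      _ = 2 ^ ν * x ^ ν := Real.mul_rpow two_pos.le hx
      _ ≤ 2 ^ ν * (x ^ ν + y ^ ν) := by gcongr; exact le_add_of_nonneg_right (by positivity)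

-- Let `σ → 0` in `|1 - σ * g lam σ| ≤ γ`, where `|g lam σ| ≤ B / lam`.
theorem IsRegularizationFamily.one_le (hg : IsRegularizationFamily s g D B γ)
    (hlam : lam ∈ Set.Ioc 0 s) : 1 ≤ γ := by
  have hB := hg.B_pos
  have hlam0 := hlam.1
  refine le_of_forall_pos_le_add fun ε hε => ?_
  set σ := min s (ε * lam / B)
  have hσ0 : 0 < σ := lt_min (hlam.1.trans_le hlam.2) (by positivity)
  have hσ : σ ∈ Set.Ioc 0 s := ⟨hσ0, min_le_left _ _⟩
  have hsmall : σ * g lam σ ≤ ε := by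
    calc σ * g lam σ ≤ σ * |g lam σ| := by gcongr; exact le_abs_self _
      _ ≤ ε * lam / B * (B / lam) := by
          gcongr
          exacts [min_le_right _ _, hg.bound lam hlam σ hσ]
      _ = ε := by field_simp
  linarith [(abs_le.mp (hg.bound_residual lam hlam σ hσ)).2]

theorem HasQualification.nonneg (hν : HasQualification s g ν γν) (hlam : lam ∈ Set.Ioc 0 s) :
    0 ≤ γν := by
  have hpow : 0 < lam ^ ν := Real.rpow_pos_of_pos hlam.1 ν
  exact nonneg_of_mul_nonneg_left ((by positivity : (0 : ℝ) ≤ _).trans (hν.2 lam hlam lam hlam))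
    hpow

/-- The bounds on `g lam` concern `(0, s]` only; its value at `0`, on which the estimator does not
depend, is replaced by `0`. -/
theorem HasQualification.abs_residual_mul_rpow_le (hν : HasQualification s g ν γν)
    (hg : IsRegularizationFamily s g D B γ) (hlam : lam ∈ Set.Ioc 0 s) (ht : t ∈ Set.Icc 0 s) :
    |1 - t * Function.update (g lam) 0 0 t| * (t + lam) ^ ν ≤ 2 ^ ν * (γν + γ) * lam ^ ν := by
  have hlam0 := hlam.1
  have hγν := hν.nonneg hlam
  set r := |1 - t * Function.update (g lam) 0 0 t| with hr
  obtain ⟨hrγ, hrν⟩ : r ≤ γ ∧ r * t ^ ν ≤ γν * lam ^ ν := by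
    rcases ht.1.eq_or_lt with rfl | ht0
    · simp only [hr, zero_mul, sub_zero, abs_one, one_mul, Real.zero_rpow hν.1.ne']
      exact ⟨hg.one_le hlam, by positivity⟩
    · rw [hr, Function.update_of_ne ht0.ne']
      exact ⟨hg.bound_residual lam hlam t ⟨ht0, ht.2⟩, hν.2 lam hlam t ⟨ht0, ht.2⟩⟩
  calc r * (t + lam) ^ ν ≤ r * (2 ^ ν * (t ^ ν + lam ^ ν)) := by
        gcongr
        exact add_rpow_le_two_rpow_mul ht.1 hlam0.le hν.1.le
    _ = 2 ^ ν * (r * t ^ ν + r * lam ^ ν) := by ring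
    _ ≤ 2 ^ ν * (γν * lam ^ ν + γ * lam ^ ν) := by gcongr
    _ = 2 ^ ν * (γν + γ) * lam ^ ν := by ring

theorem IsRegularizationFamily.abs_update_le (hg : IsRegularizationFamily s g D B γ)
    (hlam : lam ∈ Set.Ioc 0 s) (ht : t ∈ Set.Icc 0 s) :
    |Function.update (g lam) 0 0 t| ≤ B / lam := by
  rcases ht.1.eq_or_lt with rfl | ht0
  · rw [Function.update_self, abs_zero]
    exact div_nonneg hg.B_pos.le hlam.1.le
  · rw [Function.update_of_ne ht0.ne']
    exact hg.bound lam hlam t ⟨ht0, ht.2⟩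

theorem IsRegularizationFamily.mul_abs_update_le (hg : IsRegularizationFamily s g D B γ)
    (hlam : lam ∈ Set.Ioc 0 s) (ht : t ∈ Set.Icc 0 s) :
    t * |Function.update (g lam) 0 0 t| ≤ D := by
  rcases ht.1.eq_or_lt with rfl | ht0
  · rw [zero_mul]
    exact hg.D_pos.le
  · rw [Function.update_of_ne ht0.ne']
    simpa only [abs_mul, abs_of_pos ht0] using hg.bound_mul lam hlam t ⟨ht0, ht.2⟩

theorem IsRegularizationFamily.abs_update_mul_sqrt_le (hg : IsRegularizationFamily s g D B γ)
    (hlam : lam ∈ Set.Ioc 0 s) (ht : t ∈ Set.Icc 0 s) :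
    |Function.update (g lam) 0 0 t| * √(t + lam) ≤ (B + D) / √lam := by
  have hlam0 := hlam.1
  have hB := hg.B_pos
  have hD := hg.D_pos
  have ht0 := ht.1
  have hfB := hg.abs_update_le hlam ht
  have hfD := hg.mul_abs_update_le hlam ht
  set f := |Function.update (g lam) 0 0 t|
  refine le_of_sq_le_sq ?_ (by positivity)
  rw [mul_pow, Real.sq_sqrt (by positivity), div_pow, Real.sq_sqrt hlam0.le]
  have hflam : f * lam ≤ B := (le_div_iff₀ hlam0).mp hfB
  calc f ^ 2 * (t + lam) = f * (t * f + f * lam) := by ring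
    _ ≤ B / lam * (D + B) := by gcongr
    _ ≤ (B + D) ^ 2 / lam := by
        rw [div_mul_eq_mul_div]
        gcongr
        nlinarith

end FilterFunctions

section ErrorDecomposition

variable {E F ι ι' : Type*} [NormedAddCommGroup E] [InnerProductSpace ℝ E] [CompleteSpace E]
  [NormedAddCommGroup F] [InnerProductSpace ℝ F] [CompleteSpace F] {C C' : E →L[ℝ] E}
  {T T₀ R : E →L[ℝ] F}

omit [CompleteSpace E] [CompleteSpace F] in
theorem sub_comp_func_eq (d : PosEigenbasis ι C) {f : ℝ → ℝ} (hf : d.Bdd f) :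
    T - R ∘L d.func f
      = T ∘L d.func (fun t => 1 - t * f t) + (R - T ∘L C) ∘L d.func fun t => -f t := by
  have hid : d.Bdd id := d.bdd_of_continuousOn continuousOn_id
  have hneg : d.Bdd fun t => -f t := hf.imp fun K hK i => (abs_neg _).trans_le (hK i)
  have hres : d.Bdd fun t => 1 - t * f t := by
    obtain ⟨K, hK⟩ := hid.mul hf
    exact ⟨1 + K, fun i => (abs_sub _ _).trans (add_le_add abs_one.le (hK i))⟩
  refine ext_basis d.basis fun i => ?_
  simp only [add_apply, sub_apply, ContinuousLinearMap.comp_apply,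
    PosEigenbasis.func_apply_basis hf, PosEigenbasis.func_apply_basis hneg,
    PosEigenbasis.func_apply_basis hres, map_smul, d.apply_basis]
  module

variable {s lam : ℝ} {g : ℝ → ℝ → ℝ} {D B γ ν γν : ℝ} {φ : ℝ → ℝ} {c ε η : ℝ}

theorem hsNorm_sub_comp_func_update_le [Countable ι] [Countable ι'] (d : PosEigenbasis ι C)
    (d' : PosEigenbasis ι' C') (hC : ‖C‖ ≤ s) (hC' : ‖C'‖ ≤ s)
    (hg : IsRegularizationFamily s g D B γ) (hν : HasQualification s g ν γν)
    (hφ : IsIndexFunction φ) (hc : Covers s ν φ c) (hT : IsHilbertSchmidt T)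
    (hT₀ : IsHilbertSchmidt T₀) (hsource : T = T₀ ∘L d.func φ) (hlam : lam ∈ Set.Ioc 0 s)
    (hε : ‖d.shiftPow lam (-(1 / 2)) * (C' - C)‖ ≤ √lam * ε) (hε2 : ε ≤ 1 / 2)
    (hW : IsHilbertSchmidt ((R - T ∘L C') ∘L d.shiftPow lam (-(1 / 2))))
    (hη : hsNorm ((R - T ∘L C') ∘L d.shiftPow lam (-(1 / 2))) ≤ √lam * η) :
    hsNorm (T - R ∘L d'.func (Function.update (g lam) 0 0)) ≤
      hsNorm T * (⌊ν⌋₊ * ε * (2 ^ ν * (γν + γ))) +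
        hsNorm T₀ * (max 1 (1 / c) * φ lam * 2 ^ (ν - ⌊ν⌋₊) * (2 ^ ν * (γν + γ))) +
        √2 * (B + D) * η := by
  have hγ := hg.γ_pos
  have hγν := hν.nonneg hlam
  have hB := hg.B_pos
  have hD := hg.D_pos
  have hφlam := hφ.pos hlam.1
  have hspec (i : ι) : d.eigenvalue i ∈ Set.Icc 0 s :=
    ⟨d.eigenvalue_nonneg i, (d.eigenvalue_le_norm i).trans hC⟩
  have hspec' (j : ι') : d'.eigenvalue j ∈ Set.Icc 0 s :=
    ⟨d'.eigenvalue_nonneg j, (d'.eigenvalue_le_norm j).trans hC'⟩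
  have hsqrt : 0 < √lam := Real.sqrt_pos.mpr hlam.1
  have hε' := d.norm_shiftPow_neg_one_mul_le hlam.1 hε
  rw [mul_div_cancel_left₀ _ hsqrt.ne'] at hε'
  have hresidual := d.hsNorm_comp_func_residual_le d' hlam.1 hε' hε2 hT hT₀ hsource hν.1.le
    (ρ := fun t => 1 - t * Function.update (g lam) 0 0 t) (R := 2 ^ ν * (γν + γ))
    (by positivity) (by positivity)
    (fun i => hc.abs_mul_rpow_neg_le hφ hν.1.le hlam (hspec i))
    fun j => hν.abs_residual_mul_rpow_le hg hlam (hspec' j)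
  have hfilter := d.hsNorm_comp_func_filter_le d' hlam.1 (hε'.trans hε2) hW hη
    (f := fun t => -Function.update (g lam) 0 0 t) (by positivity)
    fun j => (abs_neg (Function.update (g lam) 0 0 (d'.eigenvalue j))).symm ▸
      hg.abs_update_mul_sqrt_le hlam (hspec' j)
  rw [sub_comp_func_eq d' ⟨B / lam, fun j => hg.abs_update_le hlam (hspec' j)⟩]
  refine (hresidual.1.add hfilter.1).2.trans (add_le_add hresidual.2 (hfilter.2.trans_eq ?_))
  field_simp

end ErrorDecomposition

section DeviationRate

/-- The rate `(a / (n λ) + w √(N / (n λ))) log (2 / δ)` of the stochastic error with confidence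
`1 - δ`, where `N` is the effective dimension at `λ`. -/
noncomputable def deviationRate (n : ℕ) (lam N δ a w : ℝ) : ℝ :=
  (a / (n * lam) + w * √(N / (n * lam))) * Real.log (2 / δ)

theorem deviationRate_linear (n : ℕ) (lam N δ p q a w a' w' : ℝ) :
    p * deviationRate n lam N δ a w + q * deviationRate n lam N δ a' w'
      = deviationRate n lam N δ (p * a + q * a') (p * w + q * w') := by
  simp only [deviationRate]
  ring

theorem log_two_div_nonneg {δ : ℝ} (hδ : δ ∈ Set.Ioo (0 : ℝ) 1) : 0 ≤ Real.log (2 / δ) :=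
  Real.log_nonneg ((one_le_div hδ.1).mpr (hδ.2.le.trans one_le_two))

variable {n : ℕ} {lam N δ a w : ℝ}

theorem deviationRate_mono (hlam : 0 ≤ lam) (hδ : δ ∈ Set.Ioo (0 : ℝ) 1) {a' w' : ℝ}
    (ha : a ≤ a') (hw : w ≤ w') : deviationRate n lam N δ a w ≤ deviationRate n lam N δ a' w' := by
  have hlog := log_two_div_nonneg hδ
  unfold deviationRate
  gcongr

theorem deviationRate_nonneg (hlam : 0 ≤ lam) (hδ : δ ∈ Set.Ioo (0 : ℝ) 1) (ha : 0 ≤ a)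
    (hw : 0 ≤ w) : 0 ≤ deviationRate n lam N δ a w := by
  have hlog := log_two_div_nonneg hδ
  unfold deviationRate
  positivity

variable {b : ℝ} (hn : 0 < n) (hlam : 0 < lam) (hb : 0 ≤ b) (hw : 0 ≤ w)

include hn hlam hb hw

theorem sqrt_mul_effDim_eq :
    √(n * (b * w ^ 2 * N)) = n * √lam * (√b * w * √(N / (n * lam))) := by
  have : (0 : ℝ) < n := Nat.cast_pos.mpr hn
  calc √(n * (b * w ^ 2 * N)) = √((n * w) ^ 2 * (lam * (b * (N / (n * lam))))) := by
        congr 1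
        field_simp
    _ = n * √lam * (√b * w * √(N / (n * lam))) := by
        rw [Real.sqrt_mul (sq_nonneg _), Real.sqrt_sq (by positivity), Real.sqrt_mul hlam.le,
          Real.sqrt_mul hb]
        ring

theorem sqrt_mul_deviationRate_eq :
    √lam * deviationRate n lam N δ a (√b * w)
      = (n : ℝ)⁻¹ * ((a * lam ^ (-(1 / 2) : ℝ) + √(n * (b * w ^ 2 * N))) * Real.log (2 / δ)) := by
  have : (0 : ℝ) < n := Nat.cast_pos.mpr hn
  have := Real.sqrt_pos.mpr hlam
  have hrpow : lam ^ (-(1 / 2) : ℝ) = √lam / lam := by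
    rw [Real.rpow_neg hlam.le, ← Real.sqrt_eq_rpow, Real.sqrt_div_self']
    exact inv_eq_one_div _
  rw [sqrt_mul_effDim_eq hn hlam hb hw, hrpow, deviationRate]
  field_simp

theorem lt_of_sqrt_mul_deviationRate_lt {K t : ℝ}
    (h : √lam * (K * deviationRate n lam N δ a (√b * w)) < (n : ℝ)⁻¹ * t) :
    K * (a * lam ^ (-(1 / 2) : ℝ) + √(n * (b * w ^ 2 * N))) * Real.log (2 / δ) < t := by
  have hn' : (0 : ℝ) < n := Nat.cast_pos.mpr hn
  rw [mul_left_comm, sqrt_mul_deviationRate_eq hn hlam hb hw, mul_left_comm, ← mul_assoc K] at h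
  exact lt_of_mul_lt_mul_left h (by positivity)

theorem threshold_eq_sqrt_mul_deviationRate :
    2 * (2 * b * w ^ 2 / (√lam * n) + √(b * w ^ 2 * N / n)) * Real.log (2 / δ)
      = √lam * (2 * deviationRate n lam N δ (2 * b * w ^ 2) (√b * w)) := by
  have : (0 : ℝ) < n := Nat.cast_pos.mpr hn
  have := Real.sqrt_pos.mpr hlam
  have hdim : √(b * w ^ 2 * N / n) = (n : ℝ)⁻¹ * √(n * (b * w ^ 2 * N)) := by
    rw [show b * w ^ 2 * N / n = (n : ℝ)⁻¹ ^ 2 * (n * (b * w ^ 2 * N)) by field_simp,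
      Real.sqrt_mul (sq_nonneg _), Real.sqrt_sq (by positivity)]
  rw [hdim, mul_left_comm (√lam), sqrt_mul_deviationRate_eq hn hlam hb hw, Real.rpow_neg hlam.le,
    ← Real.sqrt_eq_rpow]
  field_simp

end DeviationRate

section Deviation

theorem norm_inv_smul_sum_sub {K : Type*} [NormedAddCommGroup K] [NormedSpace ℝ K] {n : ℕ}
    (hn : 0 < n) (f : Fin n → K) (m : K) :
    ‖(n : ℝ)⁻¹ • ∑ i, f i - m‖ = (n : ℝ)⁻¹ * ‖∑ i, (f i - m)‖ := by
  have hn' : (0 : ℝ) < n := Nat.cast_pos.mpr hn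
  rw [← Real.norm_of_nonneg (inv_nonneg.mpr hn'.le), ← norm_smul, Finset.sum_sub_distrib,
    Finset.sum_const, Finset.card_univ, Fintype.card_fin, smul_sub, ← Nat.cast_smul_eq_nsmul ℝ,
    Real.norm_of_nonneg (inv_nonneg.mpr hn'.le), inv_smul_smul₀ hn'.ne']

variable {X Y H ι : Type*} [NormedAddCommGroup Y] [InnerProductSpace ℝ Y] [CompleteSpace Y]
  [NormedAddCommGroup H] [InnerProductSpace ℝ H] [CompleteSpace H] [RKHS ℝ H X ℝ] {n : ℕ}

omit [NormedAddCommGroup Y] [InnerProductSpace ℝ Y] [CompleteSpace Y] in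
theorem norm_mul_sampleCov_sub_covOp_le [MeasurableSpace X] {qX : Measure X}
    (hψ : MemLp (feature H) 2 qX) (hn : 0 < n) (β : X → ℝ) (z : Fin n → X × Y) {D : H →L[ℝ] H}
    (hD : D.adjoint = D) :
    ‖D * (sampleCov H β z - covOp H qX)‖ ≤ (n : ℝ)⁻¹ *
      ‖∑ i, (β (z i).1 • hilbertTensor H H (D (feature H (z i).1)) (feature H (z i).1) -
        ∫ x, hilbertTensor H H (D (feature H x)) (feature H x) ∂qX)‖ := by
  have hA := isTensor_hilbertTensor H H
  rw [← norm_inv_smul_sum_sub hn]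
  exact norm_mul_empCross_self_sub_le hA _ (fun i => feature H (z i).1)
    (isPositive_secondMoment hψ).isSelfAdjoint.adjoint_eq hD (inner_integral_tensor hψ hA hD)

theorem hsNorm_sampleCross_sub_comp (T : H →L[ℝ] Y) (β : X → ℝ) (z : Fin n → X × Y)
    {D : H →L[ℝ] H} (hD : D.adjoint = D) :
    hsNorm ((sampleCross H β z - T ∘L sampleCov H β z) ∘L D) = (n : ℝ)⁻¹ *
      ‖∑ i, β (z i).1 •
        hilbertTensor H Y (D (feature H (z i).1)) ((z i).2 - T (feature H (z i).1))‖ := by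
  have hnorm := (hsNorm_empCross_sub_comp (isTensor_hilbertTensor H Y) (fun i => β (z i).1)
    (fun i => feature H (z i).1) (fun i => (z i).2) T D).2
  rwa [norm_smul, Real.norm_of_nonneg (by positivity), hD] at hnorm

variable [MeasurableSpace X] [TopologicalSpace.SeparableSpace Y] [MeasurableSpace Y] [BorelSpace Y]
  {κ : ℝ} {pX qX : Measure X} [IsProbabilityMeasure pX] {P : Kernel X Y} [IsMarkovKernel P]
  {β : X → ℝ} {b M' : ℝ} {T : H →L[ℝ] Y} {δ lam : ℝ}

theorem meas_sampleCov_sampleCross_deviation_le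
    (hmeas : StronglyMeasurable (feature H : X → H)) (hκ : ∀ x : X, ‖feature H x‖ ≤ κ)
    (hq : qX = pX.withDensity fun x => ENNReal.ofReal (β x)) (hβmeas : Measurable β)
    (hβ : ∀ x, β x ∈ Set.Icc 0 b) (hM' : ∀ᵐ z ∂(pX ⊗ₘ P), ‖z.2‖ ≤ M')
    (hT : IsHilbertSchmidt T) (hreg : ∀ᵐ x ∂qX, T (feature H x) = ∫ y, y ∂(P x))
    (d : PosEigenbasis ι (covOp H qX)) (hlam : 0 < lam) (hn : 0 < n)
    (hδ : δ ∈ Set.Ioo (0 : ℝ) 1) :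
    Measure.pi (fun _ : Fin n => pX ⊗ₘ P)
      ({z | √lam * (2 * deviationRate n lam (effDim (covOp H qX) lam) δ (2 * b * κ ^ 2) (√b * κ))
          < ‖d.shiftPow lam (-(1 / 2)) * (sampleCov H β z - covOp H qX)‖} ∪
        {z | √lam * (√5 * deviationRate n lam (effDim (covOp H qX) lam) δ
            (b * κ * (M' + hsNorm T * κ)) (√b * (M' + hsNorm T * κ)))
          < hsNorm ((sampleCross H β z - T ∘L sampleCov H β z) ∘L d.shiftPow lam (-(1 / 2)))})
      ≤ ENNReal.ofReal δ := by
  have := separableSpace_of_stronglyMeasurable_feature hmeas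
  have := UniformSpace.secondCountable_of_separable Y
  have := isFiniteMeasure_of_reweighting hq fun x => (hβ x).2
  obtain ⟨z₀, hz₀⟩ := hM'.exists
  have hb : 0 ≤ b := (hβ z₀.1).1.trans (hβ z₀.1).2
  have hκ0 : 0 ≤ κ := (norm_nonneg _).trans (hκ z₀.1)
  have hM : 0 ≤ M' + hsNorm T * κ :=
    add_nonneg ((norm_nonneg _).trans hz₀) (mul_nonneg (hsNorm_nonneg T) hκ0)
  have hψ : MemLp (feature H : X → H) 2 qX :=
    .of_bound hmeas.aestronglyMeasurable κ (ae_of_all _ hκ)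
  have hadj := d.adjoint_shiftPow hlam (-(1 / 2))
  have hu : StronglyMeasurable fun x : X => d.shiftPow lam (-(1 / 2)) (feature H x) :=
    (d.shiftPow lam (-(1 / 2))).continuous.comp_stronglyMeasurable hmeas
  have hu_le (x : X) : ‖d.shiftPow lam (-(1 / 2)) (feature H x)‖ ≤ lam ^ (-(1 / 2) : ℝ) * κ :=
    ContinuousLinearMap.le_of_opNorm_le_of_le _ (d.norm_shiftPow_le hlam (by norm_num)) (hκ x)
  have hdim : effDim (covOp H qX) lam
      = ∫ x, ‖d.shiftPow lam (-(1 / 2)) (feature H x)‖ ^ 2 ∂qX := effDim_secondMoment hψ d hlam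
  have hcov := isCenteredBounded_reweighted_sub_integral (P := P) hq hβmeas hβ hu hu_le
    (isTensor_hilbertTensor H H) hmeas hκ
  have hcross := isCenteredBounded_reweighted_residual hq hβmeas hβ hu hu_le
    (isTensor_hilbertTensor H Y) measurable_id.stronglyMeasurable
    (T.continuous.comp_stronglyMeasurable hmeas) hreg hM'
    fun x => ContinuousLinearMap.le_of_opNorm_le_of_le _ hT.norm_le (hκ x)
  rw [← hdim] at hcov hcross
  refine (measure_mono (Set.union_subset_union (fun z hz => ?_) fun z hz => ?_)).trans
    (meas_norm_sum_gt_union_le hcov hcross n hδ)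
  · rw [Set.mem_ofPred_eq]
    exact lt_of_eq_of_lt (by ring) (lt_of_sqrt_mul_deviationRate_lt hn hlam hb hκ0
      (lt_of_lt_of_le hz (norm_mul_sampleCov_sub_covOp_le hψ hn β z hadj)))
  · rw [Set.mem_ofPred_eq]
    exact lt_of_eq_of_lt (by ring) (lt_of_sqrt_mul_deviationRate_lt hn hlam hb hM
      (lt_of_lt_of_eq hz (hsNorm_sampleCross_sub_comp T β z hadj)))

end Deviation

section EstimatorError

variable {X Y H G ι : Type*} [NormedAddCommGroup Y] [InnerProductSpace ℝ Y] [CompleteSpace Y]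
  [NormedAddCommGroup H] [InnerProductSpace ℝ H] [CompleteSpace H] [RKHS ℝ H X ℝ]
  [TopologicalSpace.SeparableSpace H]
  [NormedAddCommGroup G] [InnerProductSpace ℝ G] [CompleteSpace G] [RKHS ℝ G X Y] {n : ℕ}
  {s lam : ℝ} {g : ℝ → ℝ → ℝ} {D B γ ν γν : ℝ} {φ : ℝ → ℝ} {c ε η : ℝ}
  {C : H →L[ℝ] H} {T T₀ : H →L[ℝ] Y} {β : X → ℝ} {z : Fin n → X × Y} {f : G}

theorem norm_sub_estimator_le
    (hG : ∀ (x t : X) (y : Y), RKHS.kernel G x t y = scalarKernel H x t • y)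
    (hβ : ∀ x, 0 ≤ β x) (d : PosEigenbasis ι C) (hC : ‖C‖ ≤ s) (hC' : ‖sampleCov H β z‖ ≤ s)
    (hg : IsRegularizationFamily s g D B γ) (hν : HasQualification s g ν γν)
    (hφ : IsIndexFunction φ) (hc : Covers s ν φ c) (hT : IsHilbertSchmidt T)
    (hT₀ : IsHilbertSchmidt T₀) (hsource : T = T₀ ∘L d.func φ)
    (hf : ∀ x, f x = T (feature H x)) (hlam : lam ∈ Set.Ioc 0 s)
    (hε : ‖d.shiftPow lam (-(1 / 2)) * (sampleCov H β z - C)‖ ≤ √lam * ε) (hε2 : ε ≤ 1 / 2)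
    (hη : hsNorm ((sampleCross H β z - T ∘L sampleCov H β z) ∘L d.shiftPow lam (-(1 / 2)))
      ≤ √lam * η) :
    ‖f - estimator G β (g lam) z‖ ≤
      hsNorm T * (⌊ν⌋₊ * ε * (2 ^ ν * (γν + γ))) +
        hsNorm T₀ * (max 1 (1 / c) * φ lam * 2 ^ (ν - ⌊ν⌋₊) * (2 ^ ν * (γν + γ))) +
        √2 * (B + D) * η := by
  obtain ⟨ι', ⟨d'⟩⟩ := exists_posEigenbasis (T := sampleCov H β z)
    (isCompactOperator_empCross _ _ _) (isPositive_empCross (fun i => hβ (z i).1) _)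
  have := countable_of_hilbertBasis d.basis
  have := countable_of_hilbertBasis d'.basis
  have hW : IsHilbertSchmidt
      ((sampleCross H β z - T ∘L sampleCov H β z) ∘L d.shiftPow lam (-(1 / 2))) :=
    (hsNorm_empCross_sub_comp (isTensor_hilbertTensor H Y) _ _ _ T _).1
  have hbdd : d'.Bdd (Function.update (g lam) 0 0) := ⟨B / lam, fun j =>
    hg.abs_update_le hlam ⟨d'.eigenvalue_nonneg j, (d'.eigenvalue_le_norm j).trans hC'⟩⟩
  rw [estimator_congr hβ (fun t ht => (Function.update_of_ne ht 0 (g lam)).symm) z,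
    norm_sub_estimator_eq hG z d' hbdd hT hf]
  exact hsNorm_sub_comp_func_update_le d d' hC hC' hg hν hφ hc hT hT₀ hsource hlam hε hε2 hW hη

end EstimatorError

section Constants

theorem two_rpow_le_mul {ν m μ : ℝ} (hm : m ≤ ν) (hμ : 1 ≤ μ) :
    (2 : ℝ) ^ ν ≤ 2 ^ (2 * ν - m) * μ :=
  (Real.rpow_le_rpow_of_exponent_le one_le_two (by linarith)).trans
    (le_mul_of_one_le_right (by positivity) hμ)

theorem two_rpow_two_mul_sub (ν m : ℝ) : (2 : ℝ) ^ (2 * ν - m) = 2 ^ (ν - m) * 2 ^ ν := by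
  rw [← Real.rpow_add two_pos, ← add_sub_right_comm, ← two_mul]

variable {n m : ℕ} {lam N δ b κ M Bs Bo Γ μ ν Φ E : ℝ}

theorem noise_rate_le (hlam : 0 ≤ lam) (hδ : δ ∈ Set.Ioo (0 : ℝ) 1) (hb : 0 ≤ b) (hκ : 0 ≤ κ)
    (hM : 0 ≤ M) (hE : 0 ≤ E) :
    √2 * E * (√5 * deviationRate n lam N δ (b * κ * M) (√b * M)) ≤
      √10 * E * deviationRate n lam N δ (2 * (b * κ * M)) (√b * M) := by
  have hten : √10 = √2 * √5 := by
    rw [← Real.sqrt_mul zero_le_two]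
    norm_num
  have hdouble : b * κ * M ≤ 2 * (b * κ * M) := le_mul_of_one_le_left (by positivity) one_le_two
  calc √2 * E * (√5 * deviationRate n lam N δ (b * κ * M) (√b * M))
      = √10 * E * deviationRate n lam N δ (b * κ * M) (√b * M) := by rw [hten]; ring
    _ ≤ √10 * E * deviationRate n lam N δ (2 * (b * κ * M)) (√b * M) :=
        mul_le_mul_of_nonneg_left (deviationRate_mono hlam hδ hdouble le_rfl) (by positivity)

theorem approximation_add_noise_le
    (hlam : 0 ≤ lam) (hδ : δ ∈ Set.Ioo (0 : ℝ) 1) (hb : 0 ≤ b) (hκ : 0 ≤ κ) (hM : 0 ≤ M)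
    (hE : 0 ≤ E) (hBs : 0 ≤ Bs) (hΓ : 0 ≤ Γ) (hμ : 1 ≤ μ) (hm : (m : ℝ) ≤ ν) :
    Bs * (m * (2 * deviationRate n lam N δ (2 * b * κ ^ 2) (√b * κ)) * (2 ^ ν * Γ)) +
        Bo * (μ * Φ * 2 ^ (ν - m) * (2 ^ ν * Γ)) +
        √2 * E * (√5 * deviationRate n lam N δ (b * κ * M) (√b * M)) ≤
      deviationRate n lam N δ
        (2 ^ (2 * ν - m + 2) * Γ * μ * m * b * κ ^ 2 * Bs + 2 * √10 * b * M * κ * E)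
        (2 ^ (2 * ν - m + 1) * Γ * μ * m * √b * κ * Bs + √10 * √b * M * E) +
      2 ^ (2 * ν - m) * Γ * μ * Bo * Φ := by
  have hrate : 0 ≤ deviationRate n lam N δ (2 * b * κ ^ 2) (√b * κ) :=
    deviationRate_nonneg hlam hδ (by positivity) (by positivity)
  have hcov : Bs * (m * (2 * deviationRate n lam N δ (2 * b * κ ^ 2) (√b * κ)) * (2 ^ ν * Γ))
      ≤ 2 * 2 ^ (2 * ν - m) * μ * Γ * m * Bs * deviationRate n lam N δ (2 * b * κ ^ 2) (√b * κ) :=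
    calc _ ≤ Bs * (m * (2 * deviationRate n lam N δ (2 * b * κ ^ 2) (√b * κ)) *
          (2 ^ (2 * ν - m) * μ * Γ)) := by
          gcongr
          exact two_rpow_le_mul hm hμ
      _ = _ := by ring
  have hsource : Bo * (μ * Φ * 2 ^ (ν - m) * (2 ^ ν * Γ)) = 2 ^ (2 * ν - m) * Γ * μ * Bo * Φ := by
    rw [two_rpow_two_mul_sub]
    ring
  have hsum := deviationRate_linear n lam N δ (2 * 2 ^ (2 * ν - m) * μ * Γ * m * Bs) (√10 * E)
    (2 * b * κ ^ 2) (√b * κ) (2 * (b * κ * M)) (√b * M)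
  rw [hsource, Real.rpow_add two_pos, Real.rpow_add two_pos, Real.rpow_one, Real.rpow_two]
  refine ((add_le_add (add_le_add_left hcov _) (noise_rate_le hlam hδ hb hκ hM hE)).trans_eq
    (add_right_comm _ _ _)).trans_eq ?_
  rw [hsum]
  congr 2 <;> ring

end Constants

section Covariance

variable {X Y H : Type*} [NormedAddCommGroup H] [InnerProductSpace ℝ H] [CompleteSpace H]
  [RKHS ℝ H X ℝ] {κ b : ℝ} {β : X → ℝ}

theorem norm_covOp_le [MeasurableSpace X] {pX qX : Measure X} [IsProbabilityMeasure pX]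
    (hκ : ∀ x : X, ‖feature H x‖ ≤ κ) (hq : qX = pX.withDensity fun x => ENNReal.ofReal (β x))
    (hβ : ∀ x, β x ≤ b) (hb : 0 ≤ b) : ‖covOp H qX‖ ≤ b * κ ^ 2 := by
  have := isFiniteMeasure_of_reweighting hq hβ
  calc ‖covOp H qX‖ ≤ κ ^ 2 * qX.real Set.univ := norm_secondMoment_le hκ
    _ ≤ κ ^ 2 * b := by
        gcongr
        exact real_univ_le_of_reweighting hq hβ hb
    _ = b * κ ^ 2 := mul_comm _ _

theorem norm_sampleCov_le {n : ℕ} (hκ0 : 0 ≤ κ) (hκ : ∀ x : X, ‖feature H x‖ ≤ κ)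
    (hβ : ∀ x, β x ∈ Set.Icc 0 b) (hb : 0 ≤ b) (z : Fin n → X × Y) :
    ‖sampleCov H β z‖ ≤ b * κ ^ 2 := by
  rw [sq]
  exact norm_empCross_le hb hκ0 hκ0 (fun i => (abs_of_nonneg (hβ _).1).trans_le (hβ _).2)
    (fun i => hκ _) fun i => hκ _

theorem exists_posEigenbasis_covOp.{u} {H : Type u} [NormedAddCommGroup H] [InnerProductSpace ℝ H]
    [CompleteSpace H] [RKHS ℝ H X ℝ] [MeasurableSpace X] {pX qX : Measure X} [IsFiniteMeasure pX]
    (hmeas : StronglyMeasurable (feature H : X → H)) (hκ : ∀ x : X, ‖feature H x‖ ≤ κ)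
    (hq : qX = pX.withDensity fun x => ENNReal.ofReal (β x)) (hβ : ∀ x, β x ≤ b) :
    ∃ ι : Type u, Nonempty (PosEigenbasis ι (covOp H qX)) := by
  have := isFiniteMeasure_of_reweighting hq hβ
  have hψ : MemLp (feature H : X → H) 2 qX :=
    .of_bound hmeas.aestronglyMeasurable κ (ae_of_all _ hκ)
  exact exists_posEigenbasis (isCompactOperator_secondMoment hψ) (isPositive_secondMoment hψ)

end Covariance

end CovShift

open CovShift in
theorem mainTheorem2_general
    {X : Type*} [MeasurableSpace X]
    {Y : Type*} [NormedAddCommGroup Y] [InnerProductSpace ℝ Y] [CompleteSpace Y]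
    [TopologicalSpace.SeparableSpace Y] [MeasurableSpace Y] [BorelSpace Y]
    {H : Type*} [NormedAddCommGroup H] [InnerProductSpace ℝ H] [CompleteSpace H] [RKHS ℝ H X ℝ]
    {G : Type*} [NormedAddCommGroup G] [InnerProductSpace ℝ G] [CompleteSpace G] [RKHS ℝ G X Y]
    (hG : ∀ (x t : X) (y : Y), RKHS.kernel G x t y = scalarKernel H x t • y)
    (hmeas : StronglyMeasurable (feature H : X → H))
    (κ : ℝ) (hκ : 0 ≤ κ) (hk : ∀ x, scalarKernel H x x ≤ κ ^ 2)
    (pX qX : Measure X) [IsProbabilityMeasure pX] (P : Kernel X Y) [IsMarkovKernel P]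
    (β : X → ℝ) (hβmeas : Measurable β) (b : ℝ) (hβ : ∀ x, 0 ≤ β x ∧ β x ≤ b)
    (hq : qX = pX.withDensity fun x => ENNReal.ofReal (β x))
    (M' : ℝ) (hY : ∀ᵐ z ∂(pX ⊗ₘ P), ‖z.2‖ ≤ M')
    (s : ℝ) (hs : b * κ ^ 2 ≤ s) (g : ℝ → ℝ → ℝ) (D B γ : ℝ)
    (hg : IsRegularizationFamily s g D B γ)
    (ν γν : ℝ) (hν : HasQualification s g ν γν)
    (φ : ℝ → ℝ) (hφ : IsIndexFunction φ)
    (c : ℝ) (hc : Covers s ν φ c)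
    (fstar : G) (hreg : ∀ᵐ x ∂qX, fstar x = ∫ y, y ∂(P x))
    (Cstar Co : H →L[ℝ] Y) (hfC : ∀ x, fstar x = Cstar (feature H x))
    (hCo : IsHilbertSchmidt Co)
    (hsource : ∀ h, Cstar h = Co (funcCalc (covOp H qX) φ h))
    (n : ℕ) (hn : 0 < n) (δ : ℝ) (hδ : δ ∈ Set.Ioo (0 : ℝ) 1)
    (lam : ℝ) (hlam : lam ∈ Set.Ioc 0 s)
    (N : ℝ) (hN : N = effDim (covOp H qX) lam)
    (hcond : 2 * (2 * b * κ ^ 2 / (√lam * n) + √(b * κ ^ 2 * N / n)) * Real.log (2 / δ)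
      ≤ √lam / 2)
    (M A₁ A₂ A₃ : ℝ) (hM : M = M' + hsNorm Cstar * κ)
    (hA₁ : A₁ = 2 ^ (2 * ν - ⌊ν⌋₊ + 2) * (γν + γ) * max 1 (1 / c) * ⌊ν⌋₊ * b * κ ^ 2
        * hsNorm Cstar + 2 * √10 * b * M * κ * (B + D))
    (hA₂ : A₂ = 2 ^ (2 * ν - ⌊ν⌋₊ + 1) * (γν + γ) * max 1 (1 / c) * ⌊ν⌋₊ * √b * κ
        * hsNorm Cstar + √10 * √b * M * (B + D))
    (hA₃ : A₃ = 2 ^ (2 * ν - ⌊ν⌋₊) * (γν + γ) * max 1 (1 / c) * hsNorm Co) :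
    Measure.pi (fun _ : Fin n => pX ⊗ₘ P)
      {z | ¬ ‖fstar - estimator G β (g lam) z‖
        ≤ (A₁ / (n * lam) + A₂ * √(N / (n * lam))) * Real.log (2 / δ) + A₃ * φ lam}
      ≤ ENNReal.ofReal δ := by
  subst hN hM hA₁ hA₂ hA₃
  obtain ⟨z₀, hz₀⟩ := hY.exists
  have hb : 0 ≤ b := (hβ z₀.1).1.trans (hβ z₀.1).2
  have hM : 0 ≤ M' + hsNorm Cstar * κ :=
    add_nonneg ((norm_nonneg _).trans hz₀) (mul_nonneg (hsNorm_nonneg Cstar) hκ)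
  have hfeature (x : X) : ‖feature H x‖ ≤ κ := norm_feature_le hκ hk x
  have := separableSpace_of_stronglyMeasurable_feature hmeas
  obtain ⟨ι, ⟨d⟩⟩ := exists_posEigenbasis_covOp hmeas hfeature hq fun x => (hβ x).2
  have hCstar : Cstar = Co ∘L d.func φ := ContinuousLinearMap.ext fun h => (hsource h).trans <|
    congrArg Co (PosEigenbasis.funcCalc_eq_func (d.bdd_of_continuousOn hφ.continuousOn) h)
  have hHS : IsHilbertSchmidt Cstar := hCstar ▸ (hCo.comp _).1
  rw [threshold_eq_sqrt_mul_deviationRate hn hlam.1 hb hκ, div_eq_mul_one_div] at hcond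
  refine (measure_mono fun z hz => ?_).trans
    (meas_sampleCov_sampleCross_deviation_le hmeas hfeature hq hβmeas hβ hY hHS
      (hreg.mono fun x hx => (hfC x).symm.trans hx) d hlam.1 hn hδ)
  by_contra hgood
  rw [Set.mem_union, not_or, Set.mem_ofPred_eq, Set.mem_ofPred_eq, not_lt, not_lt] at hgood
  have herror := norm_sub_estimator_le hG (fun x => (hβ x).1) d
    ((norm_covOp_le hfeature hq (fun x => (hβ x).2) hb).trans hs)
    ((norm_sampleCov_le hκ hfeature hβ hb z).trans hs) hg hν hφ hc hHS hCo hCstar hfC hlam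
    hgood.1 (le_of_mul_le_mul_left hcond (Real.sqrt_pos.mpr hlam.1)) hgood.2
  exact hz (herror.trans (approximation_add_noise_le hlam.1.le hδ hb hκ hM
    (add_pos hg.B_pos hg.D_pos).le (hsNorm_nonneg Cstar)
    (add_nonneg (hν.nonneg hlam) hg.γ_pos.le) (le_max_left _ _) (Nat.floor_le hν.1.le)))

theorem mainTheorem2
    -- input space, output space, scalar RKHS `H` and vector-valued RKHS `G`
    {X : Type*} [TopologicalSpace X] [SecondCountableTopology X] [LocallyCompactSpace X] [T2Space X]
    [MeasurableSpace X] [BorelSpace X]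
    {Y : Type*} [NormedAddCommGroup Y] [InnerProductSpace ℝ Y] [CompleteSpace Y]
    [TopologicalSpace.SeparableSpace Y] [MeasurableSpace Y] [BorelSpace Y]
    {H : Type*} [NormedAddCommGroup H] [InnerProductSpace ℝ H] [CompleteSpace H] [RKHS ℝ H X ℝ]
    {G : Type*} [NormedAddCommGroup G] [InnerProductSpace ℝ G] [CompleteSpace G] [RKHS ℝ G X Y]
    -- `G` has the kernel `K(x, t) = k(x, t) Id`, where `k` is the kernel of `H`
    (hG : ∀ (x t : X) (y : Y), RKHS.kernel G x t y = CovShift.scalarKernel H x t • y)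
    (hmeas : StronglyMeasurable (CovShift.feature H : X → H))
    -- bounded kernel
    (κ : ℝ) (hκ : 0 ≤ κ) (hk : ∀ x, CovShift.scalarKernel H x x ≤ κ ^ 2)
    -- source and target marginals, conditional distribution, reweighting function
    (pX qX : Measure X) [IsProbabilityMeasure pX] [IsProbabilityMeasure qX]
    (P : Kernel X Y) [IsMarkovKernel P]
    (β : X → ℝ) (hβmeas : Measurable β) (b : ℝ) (hb : 0 < b)
    (hβ : ∀ x, 0 ≤ β x ∧ β x ≤ b)
    (hq : qX = pX.withDensity fun x => ENNReal.ofReal (β x))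
    -- bounded outputs
    (M' : ℝ) (hM' : 0 < M') (hY : ∀ᵐ z ∂(pX ⊗ₘ P), ‖z.2‖ ≤ M')
    -- regularization family, qualification, index function
    (s : ℝ) (hs : b * κ ^ 2 ≤ s) (g : ℝ → ℝ → ℝ) (D B γ : ℝ)
    (hg : CovShift.IsRegularizationFamily s g D B γ)
    (ν γν : ℝ) (hν : CovShift.HasQualification s g ν γν)
    (φ : ℝ → ℝ) (hφ : CovShift.IsIndexFunction φ)
    (c : ℝ) (hc : CovShift.Covers s ν φ c)
    -- the regression function, its operator and the source condition
    (fstar : G) (hreg : ∀ᵐ x ∂qX, fstar x = ∫ y, y ∂(P x))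
    (Cstar Co : H →L[ℝ] Y) (hfC : ∀ x, fstar x = Cstar (CovShift.feature H x))
    (hCo : CovShift.IsHilbertSchmidt Co)
    (hsource : ∀ h, Cstar h = Co (CovShift.funcCalc (CovShift.covOp H qX) φ h))
    -- sample size, confidence level, regularization parameter
    (n : ℕ) (hn : 0 < n) (δ : ℝ) (hδ : δ ∈ Set.Ioo (0 : ℝ) 1)
    (lam : ℝ) (hlam : lam ∈ Set.Ioc 0 s)
    (N : ℝ) (hN : N = CovShift.effDim (CovShift.covOp H qX) lam)
    (hcond : 2 * (2 * b * κ ^ 2 / (√lam * n) + √(b * κ ^ 2 * N / n)) * Real.log (2 / δ)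
      ≤ √lam / 2)
    -- the constants
    (M A₁ A₂ A₃ : ℝ) (hM : M = M' + CovShift.hsNorm Cstar * κ)
    (hA₁ : A₁ = 2 ^ (2 * ν - ⌊ν⌋₊ + 2) * (γν + γ) * max 1 (1 / c) * ⌊ν⌋₊ * b * κ ^ 2
        * CovShift.hsNorm Cstar + 2 * √10 * b * M * κ * (B + D))
    (hA₂ : A₂ = 2 ^ (2 * ν - ⌊ν⌋₊ + 1) * (γν + γ) * max 1 (1 / c) * ⌊ν⌋₊ * √b * κ
        * CovShift.hsNorm Cstar + √10 * √b * M * (B + D))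
    (hA₃ : A₃ = 2 ^ (2 * ν - ⌊ν⌋₊) * (γν + γ) * max 1 (1 / c) * CovShift.hsNorm Co) :
    -- for an i.i.d. sample from `p = pX ⊗ P` the bound fails with probability at most `δ`
    Measure.pi (fun _ : Fin n => pX ⊗ₘ P)
      {z | ¬ ‖fstar - CovShift.estimator G β (g lam) z‖
        ≤ (A₁ / (n * lam) + A₂ * √(N / (n * lam))) * Real.log (2 / δ) + A₃ * φ lam}
      ≤ ENNReal.ofReal δ :=
  mainTheorem2_general hG hmeas κ hκ hk pX qX P β hβmeas b hβ hq M' hY s hs g D B γ hg ν γν hν φ hφ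
    c hc fstar hreg Cstar Co hfC hCo hsource n hn δ hδ lam hlam N hN hcond M A₁ A₂ A₃ hM hA₁ hA₂ hA₃
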